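/- Let $\mathbb{H}$ be the quaternions, $\mathbb{D}=\{x\in\mathbb{H}:|x|<1\}$, $\mathbb{S}$ the sphere of imaginary units, $i\in\mathbb{S}$, $\mathbb{C}_i=\{x_0+ix_1: x_0,x_1\in\mathbb{R}\}$, $\mathbb{D}_i=\mathbb{D}\cap\mathbb{C}_i$, and let $m_i$ be the Lebesgue measure on $\mathbb{C}_i$. A real differentiable function $f:\mathbb{D}\to\mathbb{H}$ is called left slice hyperholomorphic if $f(x_0+jx_1)=a(x_0,x_1)+j\,b(x_0,x_1)$ for all $j\in\mathbb{S}$ and $x_0+jx_1\in\mathbb{D}$, with $\mathbb{H}$-valued functions $a,b$ such that $a(x_0,-x_1)=a(x_0,x_1)$, $b(x_0,-x_1)=-b(x_0,x_1)$, $\partial_{x_0}a=\partial_{x_1}b$ and $\partial_{x_0}b=-\partial_{x_1}a$. Let $\alpha>-1$ and $dA_{\alpha,i}(z)=\frac{\alpha+1}{\pi}(1-|z|^2)^\alpha\,dm_i(z)$. The slice weighted Bergman space $\mathcal{A}^2_{\alpha,i}(\mathbb{D})$ is the right quaternionic Hilbert space of all left slice hyperholomorphic $f$ on $\mathbb{D}$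 with $\int_{\mathbb{D}_i}|f|^2\,dA_{\alpha,i}<\infty$, with the scalar product $\langle f,g\rangle=\int_{\mathbb{D}_i}\overline{f(z)}\,g(z)\,dA_{\alpha,i}(z)$. For $w\in\mathbb{D}$ let $K_w$ be its reproducing kernel, i.e. $\langle K_w,f\rangle=f(w)$ for all $f$, and put $k_w=K_w/\sqrt{K_w(w)}$. Let $T$ be a bounded right linear operator on $\mathcal{A}^2_{\alpha,i}(\mathbb{D})$ that is positive, i.e. $\langle f,Tf\rangle$ is real and $\geq 0$ for all $f$. Let $\widetilde T(z)=\langle k_z,Tk_z\rangle$, $z\in\mathbb{D}_i$, be its Berezin transform, and let $\lambda_{n+1}=\inf\{\|T-F\|: F \text{ bounded right linear},\ \operatorname{rank}F\le n\}$, $n=0,1,2,\dots$, be its singular values. Then, with the Möbius invariant measure $d\mu_i(z)=\frac{1}{\pi(1-|z|^2)^2}\,dm_i(z)$ on $\mathbb{D}_i$, $$\sum_{n=1}^{\infty}\lambda_n=(\alpha+1)\int_{\mathbb{D}_i}\widetilde T(z)\,d\mu_i(z),$$ as an equality in $[0,+\infty]$. The same equality holds if $(\lambda_n)_{n\ge1}$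 is instead the decreasing sequence of nonnegative coefficients in any singular value decomposition $Tf=\sum_{n}\sigma_n\lambda_n\langle e_n,f\rangle$ with orthonormal sequences $(e_n)$ and $(\sigma_n)$; for compact $T$, this is the usual definition of the singular values. -/

import Mathlib

open MeasureTheory
open scoped Quaternion ENNReal

noncomputable section

namespace SliceBergman

/-- The sphere `𝕊` of imaginary units of the quaternions. -/
def imaginaryUnits : Set ℍ := {x | x.re = 0 ∧ ‖x‖ = 1}

/-- The open unit ball `𝔻` of the quaternions. -/
def unitBall : Set ℍ := Metric.ball 0 1

/-- The point `x₀ + J x₁` of the slice `ℂ_J`, for `z = x₀ + x₁ √-1`. For `J ∈ 𝕊` this is the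
standard identification of `ℂ` with `ℂ_J`; it maps the complex unit disc onto `𝔻 ∩ ℂ_J`. -/
def slicePoint (J : ℍ) (z : ℂ) : ℍ := (z.re : ℍ) + J * (z.im : ℍ)

/-- The pairs `(x₀, x₁)`, seen as points `x₀ + x₁ √-1` of the plane, that parametrize `U`. -/
def profile (U : Set ℍ) : Set ℂ := {z | ∃ J ∈ imaginaryUnits, slicePoint J z ∈ U}

/-- Left slice hyperholomorphic functions on an axially symmetric open set `U`: real differentiable
functions of the form `f (x₀ + J x₁) = a (x₀, x₁) + J b (x₀, x₁)`, for all imaginary units `J`,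
where `a` is even and `b` is odd in `x₁`, and `a`, `b` satisfy the Cauchy-Riemann system
`∂a/∂x₀ = ∂b/∂x₁`, `∂b/∂x₀ = -∂a/∂x₁`.
The plane of the pairs `(x₀, x₁)` is written as `ℂ`, so that `(x₀, -x₁)` is the conjugate, and the
partial derivatives are the derivatives in the directions `1` and `Complex.I`. -/
def IsLeftSliceHyperholomorphic (U : Set ℍ) (f : ℍ → ℍ) : Prop :=
  DifferentiableOn ℝ f U ∧
  ∃ a b : ℂ → ℍ,
    (∀ J ∈ imaginaryUnits, ∀ z : ℂ, slicePoint J z ∈ U → f (slicePoint J z) = a z + J * b z) ∧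
    (∀ z ∈ profile U, a (star z) = a z ∧ b (star z) = -b z) ∧
    (∀ z ∈ profile U, DifferentiableAt ℝ a z ∧ DifferentiableAt ℝ b z) ∧
    (∀ z ∈ profile U, fderiv ℝ a z 1 = fderiv ℝ b z Complex.I ∧
      fderiv ℝ b z 1 = -fderiv ℝ a z Complex.I)

/-- The measure `dA_α = (α + 1) / π * (1 - |z|²)^α dm` on the unit disc, `dm` being the Lebesgue
measure of the plane. -/
def weightedArea (α : ℝ) : Measure ℂ :=
  (volume.restrict (Metric.ball 0 1)).withDensity
    fun z => ENNReal.ofReal ((α + 1) / Real.pi * (1 - ‖z‖ ^ 2) ^ α)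

/-- The Möbius invariant measure `dμ = dm / (π (1 - |z|²)²)` on the unit disc. -/
def mobiusMeasure : Measure ℂ :=
  (volume.restrict (Metric.ball 0 1)).withDensity
    fun z => ENNReal.ofReal (1 / (Real.pi * (1 - ‖z‖ ^ 2) ^ 2))

theorem IsLeftSliceHyperholomorphic.add {U : Set ℍ} {f g : ℍ → ℍ}
    (hf : IsLeftSliceHyperholomorphic U f) (hg : IsLeftSliceHyperholomorphic U g) :
    IsLeftSliceHyperholomorphic U (f + g) := by
  obtain ⟨hfd, a, b, hab, hsym, hd, hcr⟩ := hf
  obtain ⟨hgd, a', b', hab', hsym', hd', hcr'⟩ := hg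
  refine ⟨hfd.add hgd, a + a', b + b', ?_, ?_, ?_, ?_⟩
  · intro J hJ z hz
    simp only [Pi.add_apply, hab J hJ z hz, hab' J hJ z hz, mul_add]
    abel
  · intro z hz
    simp only [Pi.add_apply, (hsym z hz).1, (hsym z hz).2, (hsym' z hz).1, (hsym' z hz).2]
    exact ⟨trivial, by abel⟩
  · intro z hz
    exact ⟨(hd z hz).1.add (hd' z hz).1, (hd z hz).2.add (hd' z hz).2⟩
  · intro z hz
    rw [fderiv_add (hd z hz).1 (hd' z hz).1, fderiv_add (hd z hz).2 (hd' z hz).2]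
    simp only [add_apply, (hcr z hz).1, (hcr z hz).2, (hcr' z hz).1,
      (hcr' z hz).2]
    exact ⟨trivial, by abel⟩

theorem IsLeftSliceHyperholomorphic.zero (U : Set ℍ) :
    IsLeftSliceHyperholomorphic U (0 : ℍ → ℍ) := by
  refine ⟨differentiableOn_const 0, 0, 0, ?_, ?_, ?_, ?_⟩
  · intro J _ z _
    simp
  · intro z _
    simp
  · intro z _
    exact ⟨differentiableAt_const 0, differentiableAt_const 0⟩
  · intro z _
    simp

/-- Right multiplication by a quaternion, as a real continuous linear map. -/
def mulRight (q : ℍ) : ℍ →L[ℝ] ℍ := (ContinuousLinearMap.mul ℝ ℍ).flip q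

theorem IsLeftSliceHyperholomorphic.mul_right {U : Set ℍ} {f : ℍ → ℍ}
    (hf : IsLeftSliceHyperholomorphic U f) (q : ℍ) :
    IsLeftSliceHyperholomorphic U (fun x => f x * q) := by
  obtain ⟨hfd, a, b, hab, hsym, hd, hcr⟩ := hf
  refine ⟨(mulRight q).differentiable.comp_differentiableOn hfd,
    fun z => mulRight q (a z), fun z => mulRight q (b z), ?_, ?_, ?_, ?_⟩
  · intro J hJ z hz
    simp only [hab J hJ z hz, mulRight, ContinuousLinearMap.flip_apply,
      ContinuousLinearMap.mul_apply', add_mul, mul_assoc]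
  · intro z hz
    simp only [(hsym z hz).1, (hsym z hz).2, map_neg]
    exact ⟨trivial, trivial⟩
  · intro z hz
    exact ⟨(mulRight q).differentiableAt.comp z (hd z hz).1,
      (mulRight q).differentiableAt.comp z (hd z hz).2⟩
  · intro z hz
    have h1 := ((mulRight q).hasFDerivAt.comp z (hd z hz).1.hasFDerivAt).fderiv
    have h2 := ((mulRight q).hasFDerivAt.comp z (hd z hz).2.hasFDerivAt).fderiv
    simp only [Function.comp_def] at h1 h2
    rw [h1, h2]
    simp only [ContinuousLinearMap.comp_apply, (hcr z hz).1, (hcr z hz).2, map_neg]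
    exact ⟨trivial, trivial⟩

/-- The slice Bergman space as a right quaternionic vector space, that is, as a submodule over
`ℍᵐᵒᵖ`: all left slice hyperholomorphic functions on `𝔻` that are square integrable on `𝔻_i` with
respect to `dA_α`. A function on `𝔻` is represented by its extension by `0` to all of `ℍ`. -/
def bergmanSubmodule (α : ℝ) (i : imaginaryUnits) : Submodule ℍᵐᵒᵖ (ℍ → ℍ) where
  carrier := {f | IsLeftSliceHyperholomorphic unitBall f ∧ (∀ x ∉ unitBall, f x = 0) ∧
    MemLp (fun z => f (slicePoint i z)) 2 (weightedArea α)}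
  add_mem' := by
    rintro f g ⟨hf, hf0, hfL⟩ ⟨hg, hg0, hgL⟩
    refine ⟨hf.add hg, fun x hx => ?_, hfL.add hgL⟩
    simp [hf0 x hx, hg0 x hx]
  zero_mem' := ⟨IsLeftSliceHyperholomorphic.zero _, fun _ _ => rfl, MemLp.zero⟩
  smul_mem' := by
    rintro q f ⟨hf, hf0, hfL⟩
    refine ⟨hf.mul_right q.unop, fun x hx => ?_, (mulRight q.unop).comp_memLp' hfL⟩
    simp [hf0 x hx]

/-- The weighted slice Bergman space `A²_{α,i}(𝔻)`. -/
def BergmanSpace (α : ℝ) (i : imaginaryUnits) : Type := bergmanSubmodule α i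

variable {α : ℝ} {i : imaginaryUnits}

instance : AddCommGroup (BergmanSpace α i) :=
  inferInstanceAs (AddCommGroup (bergmanSubmodule α i))

instance : Module ℍᵐᵒᵖ (BergmanSpace α i) :=
  inferInstanceAs (Module ℍᵐᵒᵖ (bergmanSubmodule α i))

instance : CoeFun (BergmanSpace α i) (fun _ => ℍ → ℍ) := ⟨fun f => f.1⟩

theorem BergmanSpace.memLp (f : BergmanSpace α i) :
    MemLp (fun z => f (slicePoint i z)) 2 (weightedArea α) := f.2.2.2

/-- Restriction to the slice `𝔻_i`, as a map into `L²(dA_α)`. -/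
def BergmanSpace.toL2 (α : ℝ) (i : imaginaryUnits) :
    BergmanSpace α i →+ Lp ℍ 2 (weightedArea α) where
  toFun f := f.memLp.toLp _
  map_zero' := rfl
  map_add' _ _ := rfl

/-- The norm `‖f‖ = (∫_{𝔻_i} |f|² dA_α)^{1/2}`. For `α > -1` it is definite. -/
instance : SeminormedAddCommGroup (BergmanSpace α i) :=
  SeminormedAddCommGroup.induced _ _ (BergmanSpace.toL2 α i)

theorem BergmanSpace.norm_sq_eq (f : BergmanSpace α i) :
    ‖f‖ ^ 2 = ∫ z, ‖f (slicePoint i z)‖ ^ 2 ∂weightedArea α := by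
  have h : ‖f‖ = (eLpNorm (fun z => f (slicePoint i z)) 2 (weightedArea α)).toReal :=
    Lp.norm_toLp _ f.memLp
  rw [h, f.memLp.eLpNorm_eq_integral_rpow_norm (by norm_num) (by norm_num),
    ENNReal.toReal_ofReal (by positivity), ← Real.rpow_natCast, ← Real.rpow_mul (by positivity)]
  norm_num

/-- The scalar product `⟨f, g⟩ = ∫_{𝔻_i} conj (f z) * g z dA_α(z)`, right linear in `g`. -/
instance : Inner ℍ (BergmanSpace α i) :=
  ⟨fun f g => ∫ z, star (f (slicePoint i z)) * g (slicePoint i z) ∂weightedArea α⟩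

open Classical in
/-- The reproducing kernel `K_w`: the element of the space with `⟨K_w, f⟩ = f w` for all `f`
(with the value `0` in case there is none, which does not happen for `α > -1` and `w ∈ 𝔻`). -/
def kernel (α : ℝ) (i : imaginaryUnits) (w : ℍ) : BergmanSpace α i :=
  if h : ∃ K : BergmanSpace α i, ∀ f : BergmanSpace α i, inner ℍ K f = f w then h.choose else 0

/-- The normalized reproducing kernel `k_w = K_w / √K(w, w)`, where `K(q, w) = K_w q`
(the number `K(w, w) = ‖K_w‖²` is real). -/
def normalizedKernel (α : ℝ) (i : imaginaryUnits) (w : ℍ) : BergmanSpace α i :=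
  MulOpposite.op (((Real.sqrt (kernel α i w w).re)⁻¹ : ℝ) : ℍ) • kernel α i w

/-- The Berezin transform `T̃(w) = ⟨k_w, T k_w⟩` of a bounded right linear operator. -/
def berezin (T : BergmanSpace α i →L[ℍᵐᵒᵖ] BergmanSpace α i) (w : ℍ) : ℍ :=
  inner ℍ (normalizedKernel α i w) (T (normalizedKernel α i w))

section Operators

variable {E : Type*} [SeminormedAddCommGroup E] [Module ℍᵐᵒᵖ E]

/-- `T` is positive: `⟨x, T x⟩` is a nonnegative real number for every `x`. -/
def IsPositiveOperator [Inner ℍ E] (T : E →L[ℍᵐᵒᵖ] E) : Prop :=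
  ∀ x : E, (inner ℍ x (T x) : ℍ).im = 0 ∧ 0 ≤ (inner ℍ x (T x) : ℍ).re

/-- Orthonormal sequences for a quaternionic scalar product. -/
def IsOrthonormalSeq [Inner ℍ E] (e : ℕ → E) : Prop :=
  ∀ m n, inner ℍ (e m) (e n) = if m = n then (1 : ℍ) else 0

/-- `s 0 ≥ s 1 ≥ …` are the coefficients of a singular value decomposition
`T x = ∑ σ_n s_n ⟨e_n, x⟩` with orthonormal sequences `e` and `σ`. -/
def IsSingularValueSeq [Inner ℍ E] (T : E →L[ℍᵐᵒᵖ] E) (s : ℕ → ℝ) : Prop :=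
  (∀ n, 0 ≤ s n) ∧ Antitone s ∧ ∃ e σ : ℕ → E, IsOrthonormalSeq e ∧ IsOrthonormalSeq σ ∧
    ∀ x : E, HasSum (fun n => MulOpposite.op ((s n : ℍ) * inner ℍ (e n) x) • σ n) (T x)

/-- The operator norm of a bounded right linear operator. -/
def operatorNorm (T : E →L[ℍᵐᵒᵖ] E) : ℝ := sInf {c : ℝ | 0 ≤ c ∧ ∀ x, ‖T x‖ ≤ c * ‖x‖}

/-- The singular numbers `s_n(T) = inf {‖T - F‖ : rank F ≤ n}`, `n = 0, 1, 2, …`, of a bounded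
right linear operator, compact or not. -/
def singularNumber (T : E →L[ℍᵐᵒᵖ] E) (n : ℕ) : ℝ :=
  ⨅ F : {F : E →L[ℍᵐᵒᵖ] E // LinearMap.rank (F : E →ₗ[ℍᵐᵒᵖ] E) ≤ (n : Cardinal)},
    operatorNorm (T - F.1)

end Operators

end SliceBergman

end

/-! The theorem is a trace formula. Suppose the quadratic form of `T` splits as `⟨x, T x⟩ = ∑ |⟨u_n,
x⟩|²`. At `x = K_z` the reproducing property turns `|⟨u_n, K_z⟩|` into `|u_n(z)|`, so integration
against `dA_α` and Tonelli give `∫ ⟨K_z, T K_z⟩ dA_α = ∑ ‖u_n‖²` (`lintegral_form_of_hasSum`). Since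
`K_z(z) = (1 - |z|²)^(-(α+2))`, the left side is `(α + 1) ∫ T̃ dμ` (`lintegral_berezin`). It remains
to find such `u_n` with `‖u_n‖² = λ_n`.

If the singular numbers tend to `0`, `T` is a norm limit of finite rank operators. Its norm is then
attained at an eigenvector, which is split off as a rank one operator, and the procedure is repeated
on the remainder; the norms of the remainders are the singular numbers (`exists_hasSum_of_tendsto`).
If they stay above some `δ > 0`, both sides are infinite: for every `n`, `T` dominates `n` rank one
operators with `‖u_k‖² ≥ δ / 2` (`exists_family`), so the integral is at least `n δ / 2`. For a
singular value decomposition, positivity forces `σ_n = e_n` wherever `s_n ≠ 0`, so `u_n = √s_n e_n`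
works.

On the analytic side, a slice hyperholomorphic function restricted to a slice is holomorphic for
left multiplication by that slice, hence a power series `∑ zⁿ c_n`. Rotation invariance makes the
monomials orthogonal, and their square norms `m_n` satisfy a recursion with `∑ xⁿ / m_n = (1 -
x)^(-(α+2))`. This yields the kernel `∑ zⁿ w̄ⁿ / m_n`, and from it definiteness and completeness of
the space. -/

noncomputable section

namespace SliceBergman

open MulOpposite Filter Topology

section

/-- A right quaternionic inner product space: `inner ℍ` is conjugate symmetric, right linear in its
second argument, and induces the norm. -/
class QuaternionicInnerProductSpace (E : Type*) [NormedAddCommGroup E] [Module ℍᵐᵒᵖ E]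
    [Inner ℍ E] : Prop where
  star_inner : ∀ x y : E, star (inner ℍ x y) = inner ℍ y x
  inner_add_right' : ∀ x y z : E, inner ℍ x (y + z) = inner ℍ x y + inner ℍ x z
  inner_smul_right' : ∀ (x y : E) (q : ℍ), inner ℍ x (op q • y) = inner ℍ x y * q
  inner_self : ∀ x : E, inner ℍ x x = ((‖x‖ ^ 2 : ℝ) : ℍ)

theorem norm_sq_eq_components (q : ℍ) :
    ‖q‖ ^ 2 = q.re ^ 2 + q.imI ^ 2 + q.imJ ^ 2 + q.imK ^ 2 := by
  rw [sq, ← Quaternion.normSq_eq_norm_mul_self, Quaternion.normSq_def']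

theorem re_le_norm (q : ℍ) : q.re ≤ ‖q‖ := by
  refine abs_le_of_sq_le_sq' ?_ (norm_nonneg _) |>.2
  rw [norm_sq_eq_components]
  nlinarith [sq_nonneg q.imI, sq_nonneg q.imJ, sq_nonneg q.imK]

/-! ### Quaternionic Hermitian forms and positive operators. -/

section Abstract

set_option linter.unusedSectionVars false

variable {E : Type*} [NormedAddCommGroup E] [Module ℍᵐᵒᵖ E] [Inner ℍ E]

/-- The Cauchy-Schwarz inequality for positive semidefinite quaternionic Hermitian forms. -/
theorem norm_sq_le_of_hermitian (B : E → E → ℍ)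
    (hadd : ∀ x y z, B x (y + z) = B x y + B x z)
    (hsmul : ∀ x y q, B x (op q • y) = B x y * q)
    (hstar : ∀ x y, star (B x y) = B y x) (hpos : ∀ x, 0 ≤ (B x x).re) (x y : E) :
    ‖B x y‖ ^ 2 ≤ (B x x).re * (B y y).re := by
  have hadd' : ∀ x y z, B (x + y) z = B x z + B y z := fun x y z => by
    rw [← hstar, hadd, star_add, hstar, hstar]
  have hsmul' : ∀ x y q, B (op q • x) y = star q * B x y := fun x y q => by
    rw [← hstar, hsmul, star_mul, hstar]
  set q := B x y with hq
  have hyx : B y x = star q := (hstar x y).symm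
  -- This is the form at `x (t q) + y`. The phase `q = B x y` makes both cross terms real, and the
  -- discriminant in `t` gives the claim up to a factor `‖q‖²`.
  have key : ∀ t : ℝ, 0 ≤ (‖q‖ ^ 2 * (B x x).re) * (t * t) + (2 * ‖q‖ ^ 2) * t + (B y y).re := by
    intro t
    have h := hpos (op ((t : ℍ) * q) • x + y)
    have hxx := hstar x x
    rw [hadd, hadd', hadd', hsmul, hsmul', hsmul', hsmul, hyx, ← hq] at h
    have h1 := congrArg QuaternionAlgebra.imI hxx
    have h2 := congrArg QuaternionAlgebra.imJ hxx
    have h3 := congrArg QuaternionAlgebra.imK hxx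
    simp only [Quaternion.imI_star, Quaternion.imJ_star, Quaternion.imK_star] at h1 h2 h3
    have e1 : (B x x).imI = 0 := by linarith
    have e2 : (B x x).imJ = 0 := by linarith
    have e3 : (B x x).imK = 0 := by linarith
    rw [norm_sq_eq_components]
    simp only [Quaternion.re_add, Quaternion.re_mul, Quaternion.imI_mul, Quaternion.imJ_mul,
      Quaternion.imK_mul, Quaternion.re_star, Quaternion.imI_star, Quaternion.imJ_star,
      Quaternion.imK_star, e1, e2, e3, star_mul, Quaternion.re_coe, Quaternion.imI_coe,
      Quaternion.imJ_coe, Quaternion.imK_coe] at h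
    nlinarith [h]
  have hd := discrim_le_zero key
  rw [discrim] at hd
  rcases eq_or_lt_of_le (sq_nonneg ‖q‖) with h0 | h0
  · rw [← h0]
    exact mul_nonneg (hpos x) (hpos y)
  · have : ‖q‖ ^ 2 * ‖q‖ ^ 2 ≤ ‖q‖ ^ 2 * ((B x x).re * (B y y).re) := by nlinarith
    exact le_of_mul_le_mul_left this h0

/-- A form with real diagonal is Hermitian: this is the polarization argument behind the
symmetry of positive operators. -/
theorem hermitian_of_diagonal_real (B : E → E → ℍ)
    (hadd : ∀ x y z, B x (y + z) = B x y + B x z)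
    (hadd' : ∀ x y z, B (x + y) z = B x z + B y z)
    (hsmul : ∀ x y q, B x (op q • y) = B x y * q)
    (hsmul' : ∀ x y q, B (op q • x) y = star q * B x y)
    (hreal : ∀ x, (B x x).im = 0) (x y : E) : star (B x y) = B y x := by
  have key : ∀ q : ℍ, (B x y * q + star q * B y x).im = 0 := by
    intro q
    have h := hreal (x + op q • y)
    have hx := hreal x
    have hy := hreal (op q • y)
    rw [hadd, hadd', hadd', hsmul x y, hsmul' y x] at h
    rw [show B x x + star q * B y x + (B x y * q + B (op q • y) (op q • y))
      = B x x + B (op q • y) (op q • y) + (B x y * q + star q * B y x) by abel,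
      Quaternion.im_add, Quaternion.im_add, hx, hy, zero_add, zero_add] at h
    exact h
  -- `q = 1` shows that the imaginary parts of `B x y` and `B y x` are opposite; an imaginary unit
  -- `q` shows that the real parts agree.
  have k0 := key 1
  have k1 : ∀ q : ℍ, q.re = 0 → q.imI = 1 → q.imJ = 0 → q.imK = 0 →
      (B x y).re = (B y x).re := by
    intro q h0 h1 h2 h3
    have h := congrArg QuaternionAlgebra.imI (key q)
    simp only [Quaternion.imI_im, Quaternion.imI_add, Quaternion.imI_mul, Quaternion.re_star,
      Quaternion.imI_star, Quaternion.imJ_star, Quaternion.imK_star, h0, h1, h2, h3,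
      Quaternion.imI_zero] at h
    linarith
  have a0 := k1 ⟨0, 1, 0, 0⟩ rfl rfl rfl rfl
  have a1 := congrArg QuaternionAlgebra.imI k0
  have a2 := congrArg QuaternionAlgebra.imJ k0
  have a3 := congrArg QuaternionAlgebra.imK k0
  simp at a1 a2 a3
  ext <;> simp <;> linarith

variable [QuaternionicInnerProductSpace E]

open QuaternionicInnerProductSpace

theorem inner_add_left' (x y z : E) : inner ℍ (x + y) z = inner ℍ x z + inner ℍ y z := by
  rw [← star_inner, inner_add_right', star_add, star_inner, star_inner]

theorem inner_smul_left' (x y : E) (q : ℍ) : inner ℍ (op q • x) y = star q * inner ℍ x y := by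
  rw [← star_inner, inner_smul_right', star_mul, star_inner]

/-- `y ↦ ⟨x, y⟩` as an additive map. -/
def innerAddHom (x : E) : E →+ ℍ := AddMonoidHom.mk' (fun y => inner ℍ x y) (inner_add_right' x)

theorem inner_zero_right' (x : E) : inner ℍ x 0 = (0 : ℍ) := (innerAddHom x).map_zero

theorem inner_sub_right' (x y z : E) : inner ℍ x (y - z) = inner ℍ x y - inner ℍ x z :=
  (innerAddHom x).map_sub y z

theorem inner_neg_right' (x y : E) : inner ℍ x (-y) = -inner ℍ x y := (innerAddHom x).map_neg y

theorem inner_zero_left' (x : E) : inner ℍ 0 x = (0 : ℍ) := by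
  rw [← star_inner, inner_zero_right', star_zero]

theorem inner_sub_left' (x y z : E) : inner ℍ (x - y) z = inner ℍ x z - inner ℍ y z := by
  rw [← star_inner, inner_sub_right', star_sub, star_inner, star_inner]

theorem inner_self_re (x : E) : (inner ℍ x x : ℍ).re = ‖x‖ ^ 2 := by
  rw [inner_self, Quaternion.re_coe]

theorem norm_inner_le_norm' (x y : E) : ‖(inner ℍ x y : ℍ)‖ ≤ ‖x‖ * ‖y‖ := by
  have h := norm_sq_le_of_hermitian (fun x y : E => inner ℍ x y) inner_add_right' inner_smul_right'
    star_inner (fun x => by rw [inner_self_re]; positivity) x y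
  simp only [inner_self_re] at h
  exact abs_le_of_sq_le_sq' (by nlinarith) (by positivity) |>.2

theorem norm_inner_comm (x y : E) : ‖(inner ℍ x y : ℍ)‖ = ‖(inner ℍ y x : ℍ)‖ := by
  rw [← star_inner, norm_star]

theorem norm_op_smul (q : ℍ) (x : E) : ‖op q • x‖ = ‖q‖ * ‖x‖ := by
  have h : (inner ℍ (op q • x) (op q • x) : ℍ) = ((‖q‖ * ‖x‖) ^ 2 : ℝ) := by
    rw [inner_smul_left', inner_smul_right', inner_self, Quaternion.coe_commutes, ← mul_assoc,
      Quaternion.star_mul_self, ← Quaternion.coe_mul, Quaternion.normSq_eq_norm_mul_self]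
    congr 1
    ring
  rw [inner_self, Quaternion.coe_inj] at h
  exact (sq_eq_sq₀ (norm_nonneg _) (by positivity)).1 h

namespace IsPositiveOperator

variable {S : E →L[ℍᵐᵒᵖ] E}

theorem star_inner_apply (hS : IsPositiveOperator S) (x y : E) :
    star (inner ℍ x (S y) : ℍ) = inner ℍ y (S x) :=
  hermitian_of_diagonal_real (fun x y : E => inner ℍ x (S y))
    (fun x y z => by simp only [map_add, inner_add_right']) (fun x y z => inner_add_left' _ _ _)
    (fun x y q => by simp only [map_smul, inner_smul_right'])
    (fun x y q => inner_smul_left' _ _ _) (fun x => (hS x).1) x y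

theorem inner_apply_left (hS : IsPositiveOperator S) (x y : E) :
    (inner ℍ (S x) y : ℍ) = inner ℍ x (S y) := by
  rw [← star_inner, ← hS.star_inner_apply, star_star]

theorem norm_inner_sq_le (hS : IsPositiveOperator S) (x y : E) :
    ‖(inner ℍ x (S y) : ℍ)‖ ^ 2 ≤ (inner ℍ x (S x) : ℍ).re * (inner ℍ y (S y) : ℍ).re :=
  norm_sq_le_of_hermitian (fun x y : E => inner ℍ x (S y))
    (fun x y z => by simp only [map_add, inner_add_right'])
    (fun x y q => by simp only [map_smul, inner_smul_right'])
    hS.star_inner_apply (fun x => (hS x).2) x y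

/-- Cauchy-Schwarz for the form of `S` at the pair `(S x, x)`: `‖S x‖⁴ ≤ ⟨S x, S (S x)⟩ ⟨x, S x⟩ ≤ M
‖S x‖² ⟨x, S x⟩`. This upgrades a bound on the form to a bound on the operator. -/
theorem norm_apply_sq_le (hS : IsPositiveOperator S) {M : ℝ}
    (hM : ∀ x : E, (inner ℍ x (S x) : ℍ).re ≤ M * ‖x‖ ^ 2) (x : E) :
    ‖S x‖ ^ 2 ≤ M * (inner ℍ x (S x) : ℍ).re := by
  have h := hS.norm_inner_sq_le (S x) x
  rw [inner_self, Quaternion.norm_coe, Real.norm_eq_abs, sq_abs] at h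
  rcases eq_or_lt_of_le (sq_nonneg ‖S x‖) with h0 | h0
  · rw [← h0]
    rcases eq_or_ne x 0 with rfl | hx
    · simp [inner_zero_left']
    · have : 0 < ‖x‖ ^ 2 := by positivity
      have hM0 : 0 ≤ M := nonneg_of_mul_nonneg_left ((hS x).2.trans (hM x)) this
      exact mul_nonneg hM0 (hS x).2
  · have h2 := mul_le_mul_of_nonneg_right (hM (S x)) (hS x).2
    have : ‖S x‖ ^ 2 * ‖S x‖ ^ 2 ≤ ‖S x‖ ^ 2 * (M * (inner ℍ x (S x) : ℍ).re) := by nlinarith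
    exact le_of_mul_le_mul_left this h0

end IsPositiveOperator

/-! ### The operator norm -/

/-- `E` is not assumed to be a normed space over `ℍᵐᵒᵖ`, so boundedness is derived directly from
continuity at `0`, by rescaling `x` to norm `δ / 2` with a real quaternion. -/
theorem exists_norm_bound (T : E →L[ℍᵐᵒᵖ] E) : ∃ c : ℝ, 0 ≤ c ∧ ∀ x, ‖T x‖ ≤ c * ‖x‖ := by
  have hT : Tendsto T (𝓝 0) (𝓝 0) := by simpa using T.continuous.tendsto 0
  obtain ⟨δ, hδ, h⟩ := Metric.tendsto_nhds_nhds.1 hT 1 one_pos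
  refine ⟨2 / δ, by positivity, fun x => ?_⟩
  rcases eq_or_ne x 0 with rfl | hx
  · simp
  have hx' : 0 < ‖x‖ := norm_pos_iff.2 hx
  set r : ℝ := δ / (2 * ‖x‖) with hr
  have hr0 : 0 < r := by positivity
  have hnr : ∀ y : E, ‖op (r : ℍ) • y‖ = r * ‖y‖ := fun y => by
    rw [norm_op_smul, Quaternion.norm_coe, Real.norm_of_nonneg hr0.le]
  have h1 : ‖T (op (r : ℍ) • x)‖ < 1 := by
    have := @h (op (r : ℍ) • x) (by
      rw [dist_zero_right, hnr, hr]; field_simp; linarith)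
    simpa using this
  rw [map_smul, hnr, hr] at h1
  rw [div_mul_eq_mul_div, le_div_iff₀ hδ]
  rw [div_mul_eq_mul_div, div_lt_one (by positivity)] at h1
  linarith

theorem operatorNorm_nonneg (T : E →L[ℍᵐᵒᵖ] E) : 0 ≤ operatorNorm T :=
  Real.sInf_nonneg fun _ hc => hc.1

theorem norm_apply_le_operatorNorm (T : E →L[ℍᵐᵒᵖ] E) (x : E) :
    ‖T x‖ ≤ operatorNorm T * ‖x‖ := by
  rcases eq_or_ne x 0 with rfl | hx
  · simp
  have hx' : 0 < ‖x‖ := norm_pos_iff.2 hx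
  rw [← div_le_iff₀ hx']
  exact le_csInf (exists_norm_bound T) fun c hc => (div_le_iff₀ hx').2 (hc.2 x)

theorem operatorNorm_le {T : E →L[ℍᵐᵒᵖ] E} {c : ℝ} (hc : 0 ≤ c) (h : ∀ x, ‖T x‖ ≤ c * ‖x‖) :
    operatorNorm T ≤ c :=
  csInf_le ⟨0, fun _ hc => hc.1⟩ ⟨hc, h⟩

theorem singularNumber_le {T F : E →L[ℍᵐᵒᵖ] E} {n : ℕ}
    (hF : LinearMap.rank (F : E →ₗ[ℍᵐᵒᵖ] E) ≤ (n : Cardinal)) :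
    singularNumber T n ≤ operatorNorm (T - F) :=
  ciInf_le ⟨0, by rintro _ ⟨F, rfl⟩; exact operatorNorm_nonneg _⟩
    (⟨F, hF⟩ : {F : E →L[ℍᵐᵒᵖ] E // LinearMap.rank (F : E →ₗ[ℍᵐᵒᵖ] E) ≤ (n : Cardinal)})

instance (n : ℕ) :
    Nonempty {F : E →L[ℍᵐᵒᵖ] E // LinearMap.rank (F : E →ₗ[ℍᵐᵒᵖ] E) ≤ (n : Cardinal)} :=
  ⟨⟨0, by simp [LinearMap.rank_zero]⟩⟩

theorem le_singularNumber {T : E →L[ℍᵐᵒᵖ] E} {n : ℕ} {c : ℝ}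
    (h : ∀ F : E →L[ℍᵐᵒᵖ] E, LinearMap.rank (F : E →ₗ[ℍᵐᵒᵖ] E) ≤ (n : Cardinal) →
      c ≤ operatorNorm (T - F)) : c ≤ singularNumber T n :=
  le_ciInf fun F => h F.1 F.2

theorem singularNumber_nonneg (T : E →L[ℍᵐᵒᵖ] E) (n : ℕ) : 0 ≤ singularNumber T n :=
  le_singularNumber fun _ _ => operatorNorm_nonneg _

theorem antitone_singularNumber (T : E →L[ℍᵐᵒᵖ] E) : Antitone (singularNumber T) :=
  fun _ _ h => le_singularNumber fun _ hF => singularNumber_le (hF.trans (by exact_mod_cast h))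

theorem IsPositiveOperator.operatorNorm_le {S : E →L[ℍᵐᵒᵖ] E} (hS : IsPositiveOperator S) {M : ℝ}
    (hM0 : 0 ≤ M) (hM : ∀ x : E, (inner ℍ x (S x) : ℍ).re ≤ M * ‖x‖ ^ 2) :
    operatorNorm S ≤ M := by
  refine SliceBergman.operatorNorm_le hM0 fun x => ?_
  refine abs_le_of_sq_le_sq' ?_ (by positivity) |>.2
  have h1 := hS.norm_apply_sq_le hM x
  nlinarith [hM x]

theorem inner_apply_re_le (S : E →L[ℍᵐᵒᵖ] E) (x : E) :
    (inner ℍ x (S x) : ℍ).re ≤ operatorNorm S * ‖x‖ ^ 2 := by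
  have h1 := re_le_norm (inner ℍ x (S x))
  have h2 := norm_inner_le_norm' x (S x)
  have h3 := mul_le_mul_of_nonneg_left (norm_apply_le_operatorNorm S x) (norm_nonneg x)
  nlinarith

/-! ### Rank one operators -/

/-- The operator `x ↦ u ⟨u, x⟩`. -/
def rankOne (u : E) : E →L[ℍᵐᵒᵖ] E where
  toFun x := op (inner ℍ u x : ℍ) • u
  map_add' x y := by rw [inner_add_right', op_add, add_smul]
  map_smul' q x := by
    rw [← op_unop q, inner_smul_right', op_mul, mul_smul, RingHom.id_apply]
  cont := AddMonoidHomClass.continuous_of_bound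
    (AddMonoidHom.mk' (fun x : E => op (inner ℍ u x : ℍ) • u)
      (fun x y => by rw [inner_add_right', op_add, add_smul])) (‖u‖ * ‖u‖) (fun x => by
      rw [AddMonoidHom.mk'_apply, norm_op_smul]
      nlinarith [norm_inner_le_norm' u x, norm_nonneg u])

@[simp] theorem rankOne_apply (u x : E) : rankOne u x = op (inner ℍ u x : ℍ) • u := rfl

theorem inner_rankOne (u x y : E) :
    (inner ℍ x (rankOne u y) : ℍ) = inner ℍ x u * inner ℍ u y := by
  rw [rankOne_apply, inner_smul_right']

theorem inner_rankOne_self (u x : E) :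
    (inner ℍ x (rankOne u x) : ℍ) = ((‖(inner ℍ u x : ℍ)‖ ^ 2 : ℝ) : ℍ) := by
  rw [inner_rankOne, ← star_inner u x, Quaternion.star_mul_self,
    Quaternion.normSq_eq_norm_mul_self, sq]

theorem rank_rankOne_le (u : E) : LinearMap.rank (rankOne u : E →ₗ[ℍᵐᵒᵖ] E) ≤ 1 := by
  have : LinearMap.range (rankOne u : E →ₗ[ℍᵐᵒᵖ] E) ≤ Submodule.span ℍᵐᵒᵖ {u} := by
    rintro _ ⟨x, rfl⟩
    exact Submodule.smul_mem _ _ (Submodule.mem_span_singleton_self u)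
  exact (Submodule.rank_mono this).trans ((rank_span_le _).trans (by simp))

theorem IsPositiveOperator.sub_rankOne {S : E →L[ℍᵐᵒᵖ] E} (hS : IsPositiveOperator S) {u : E}
    (hu : ∀ x, ‖(inner ℍ u x : ℍ)‖ ^ 2 ≤ (inner ℍ x (S x) : ℍ).re) :
    IsPositiveOperator (S - rankOne u) := by
  intro x
  rw [sub_apply, inner_sub_right', inner_rankOne_self, Quaternion.im_sub,
    (hS x).1, Quaternion.im_coe, Quaternion.re_sub, Quaternion.re_coe]
  exact ⟨by simp, sub_nonneg.2 (hu x)⟩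

end Abstract

end

/-! ### Splitting rank one operators off a positive operator. -/

section Greedy

set_option linter.unusedSectionVars false

open QuaternionicInnerProductSpace

variable {E : Type*} [NormedAddCommGroup E] [Module ℍᵐᵒᵖ E] [Inner ℍ E]
  [QuaternionicInnerProductSpace E]

theorem norm_op_ofReal_smul {r : ℝ} (hr : 0 ≤ r) (x : E) : ‖op (r : ℍ) • x‖ = r * ‖x‖ := by
  rw [norm_op_smul, Quaternion.norm_coe, Real.norm_of_nonneg hr]

theorem rank_sum_rankOne_le (u : ℕ → E) (n : ℕ) :
    LinearMap.rank ((∑ k ∈ Finset.range n, rankOne (u k) : E →L[ℍᵐᵒᵖ] E) : E →ₗ[ℍᵐᵒᵖ] E)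
      ≤ (n : Cardinal) := by
  induction n with
  | zero => simp [LinearMap.rank_zero]
  | succ n ih =>
    rw [Finset.sum_range_succ, ContinuousLinearMap.toLinearMap_add, Nat.cast_succ]
    exact (LinearMap.rank_add_le _ _).trans (add_le_add ih (rank_rankOne_le _))

theorem inner_sum_rankOne_re (u : ℕ → E) (n : ℕ) (x : E) :
    (inner ℍ x ((∑ k ∈ Finset.range n, rankOne (u k)) x) : ℍ).re
      = ∑ k ∈ Finset.range n, ‖(inner ℍ (u k) x : ℍ)‖ ^ 2 := by
  induction n with
  | zero => simp [inner_zero_right']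
  | succ n ih =>
    rw [Finset.sum_range_succ, Finset.sum_range_succ, add_apply, inner_add_right',
      Quaternion.re_add, ih, inner_rankOne_self, Quaternion.re_coe]

/-- The vector is `u = S x / √⟨x, S x⟩`: Cauchy-Schwarz for the form of `S` says exactly that `|⟨u,
y⟩|² ≤ ⟨y, S y⟩`, and `‖u‖² ≥ ⟨x, S x⟩ / ‖x‖²`. The norm need not be attained, so `x` is only
required to bring this quotient above `δ / 2`. -/
theorem IsPositiveOperator.exists_sub_rankOne {S : E →L[ℍᵐᵒᵖ] E} (hS : IsPositiveOperator S)
    {δ : ℝ} (hδ : 0 < δ) (h : δ ≤ operatorNorm S) :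
    ∃ u : E, δ / 2 ≤ ‖u‖ ^ 2 ∧ IsPositiveOperator (S - rankOne u) := by
  obtain ⟨x, hx⟩ : ∃ x : E, δ / 2 * ‖x‖ ^ 2 < (inner ℍ x (S x) : ℍ).re := by
    by_contra! hcon
    linarith [hS.operatorNorm_le (by positivity) hcon]
  set t := (inner ℍ x (S x) : ℍ).re with ht
  have ht0 : 0 < t := lt_of_le_of_lt (by positivity) hx
  have hsq : (√t)⁻¹ ^ 2 = t⁻¹ := by rw [inv_pow, Real.sq_sqrt ht0.le]
  refine ⟨op (((√t)⁻¹ : ℝ) : ℍ) • S x, ?_, hS.sub_rankOne fun y => ?_⟩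
  · rw [norm_op_ofReal_smul (by positivity), mul_pow, hsq]
    have h2 : t ≤ ‖x‖ * ‖S x‖ := (re_le_norm _).trans (norm_inner_le_norm' _ _)
    have hx0 : 0 < ‖x‖ := by
      rw [norm_pos_iff]
      rintro rfl
      rw [ht, inner_zero_left'] at ht0
      simp at ht0
    have h4 : t * t ≤ ‖x‖ ^ 2 * ‖S x‖ ^ 2 := by nlinarith
    have h5 : ‖x‖ ^ 2 * (δ / 2 * t) ≤ ‖x‖ ^ 2 * ‖S x‖ ^ 2 := by nlinarith
    have h6 := le_of_mul_le_mul_left h5 (by positivity)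
    rw [inv_mul_eq_div, le_div_iff₀ ht0]
    exact h6
  · rw [inner_smul_left', Quaternion.star_coe, norm_mul, mul_pow, Quaternion.norm_coe,
      Real.norm_eq_abs, sq_abs, hsq, hS.inner_apply_left, inv_mul_le_iff₀ ht0]
    exact hS.norm_inner_sq_le x y

/-- If the singular numbers of a positive operator do not decay, then it dominates sums of
arbitrarily many rank one operators of norm bounded below. -/
theorem IsPositiveOperator.exists_family {T : E →L[ℍᵐᵒᵖ] E} (hT : IsPositiveOperator T)
    {δ : ℝ} (hδ : 0 < δ) (hs : ∀ n, δ ≤ singularNumber T n) (n : ℕ) :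
    ∃ u : ℕ → E, (∀ k < n, δ / 2 ≤ ‖u k‖ ^ 2) ∧
      ∀ x, ∑ k ∈ Finset.range n, ‖(inner ℍ (u k) x : ℍ)‖ ^ 2 ≤ (inner ℍ x (T x) : ℍ).re := by
  obtain ⟨u, hu, hpos⟩ : ∃ u : ℕ → E, (∀ k < n, δ / 2 ≤ ‖u k‖ ^ 2) ∧
      IsPositiveOperator (T - ∑ k ∈ Finset.range n, rankOne (u k)) := by
    induction n with
    | zero => exact ⟨0, by simp, by simpa using hT⟩
    | succ n ih =>
      obtain ⟨u, hu, hpos⟩ := ih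
      -- What has been subtracted has rank at most `n`, so the remainder still has norm at least
      -- `singularNumber T n ≥ δ`.
      obtain ⟨v, hv, hpos'⟩ := hpos.exists_sub_rankOne hδ
        ((hs n).trans (singularNumber_le (rank_sum_rankOne_le u n)))
      have hne : ∀ k < n, Function.update u n v k = u k := fun k hk =>
        Function.update_of_ne hk.ne _ _
      refine ⟨Function.update u n v, fun k hk => ?_, ?_⟩
      · rcases Nat.lt_succ_iff_lt_or_eq.1 hk with hk | rfl
        · rw [hne k hk]
          exact hu k hk
        · simpa using hv
      · rw [Finset.sum_range_succ, Function.update_self,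
          Finset.sum_congr rfl fun k hk => by rw [hne k (Finset.mem_range.1 hk)], ← sub_sub]
        exact hpos'
  refine ⟨u, hu, fun x => ?_⟩
  have := (hpos x).2
  rw [sub_apply, inner_sub_right', Quaternion.re_sub, inner_sum_rankOne_re] at this
  linarith

/-! ### Norm limits of finite rank operators -/

/-- `S` is a norm limit of finite rank operators. -/
def IsFiniteRankLimit (S : E →L[ℍᵐᵒᵖ] E) : Prop :=
  ∀ ε > 0, ∃ F : E →L[ℍᵐᵒᵖ] E,
    LinearMap.rank (F : E →ₗ[ℍᵐᵒᵖ] E) < Cardinal.aleph0 ∧ operatorNorm (S - F) < ε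

theorem isFiniteRankLimit_of_tendsto {T : E →L[ℍᵐᵒᵖ] E}
    (h : Tendsto (singularNumber T) atTop (𝓝 0)) : IsFiniteRankLimit T := by
  intro ε hε
  obtain ⟨n, hn⟩ := (h.eventually_lt_const hε).exists
  obtain ⟨⟨F, hF⟩, hlt⟩ := exists_lt_of_ciInf_lt hn
  exact ⟨F, hF.trans_lt (Cardinal.natCast_lt_aleph0), hlt⟩

theorem IsFiniteRankLimit.sub_rankOne {S : E →L[ℍᵐᵒᵖ] E} (hS : IsFiniteRankLimit S) (u : E) :
    IsFiniteRankLimit (S - rankOne u) := by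
  intro ε hε
  obtain ⟨F, hF, hlt⟩ := hS ε hε
  refine ⟨F - rankOne u, ?_, by rwa [sub_sub_sub_cancel_right]⟩
  have : ((F - rankOne u : E →L[ℍᵐᵒᵖ] E) : E →ₗ[ℍᵐᵒᵖ] E)
      = (F : E →ₗ[ℍᵐᵒᵖ] E) + (rankOne u : E →ₗ[ℍᵐᵒᵖ] E).comp (-LinearMap.id) := by
    ext x
    simp [sub_eq_add_neg]
  rw [this]
  exact (LinearMap.rank_add_le _ _).trans_lt (Cardinal.add_lt_aleph0 hF
    ((LinearMap.rank_comp_le_left _ _).trans_lt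
      ((rank_rankOne_le u).trans_lt Cardinal.one_lt_aleph0)))

/-- The range is finite-dimensional over `ℍᵐᵒᵖ`, hence over `ℝ`, hence proper; the image of the unit
ball lies in a compact ball of the range. -/
theorem totallyBounded_image_of_finiteRank [NormedSpace ℝ E] [IsScalarTower ℝ ℍᵐᵒᵖ E]
    (F : E →L[ℍᵐᵒᵖ] E) (hF : LinearMap.rank (F : E →ₗ[ℍᵐᵒᵖ] E) < Cardinal.aleph0) :
    TotallyBounded (F '' Metric.closedBall 0 1) := by
  set W : Submodule ℍᵐᵒᵖ E := LinearMap.range (F : E →ₗ[ℍᵐᵒᵖ] E) with hW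
  have : Module.Finite ℍᵐᵒᵖ W := Module.rank_lt_aleph0_iff.1 hF
  have : Module.Finite ℝ W := Module.Finite.trans ℍᵐᵒᵖ W
  have : FiniteDimensional ℝ (W.restrictScalars ℝ) := this
  have : ProperSpace (W.restrictScalars ℝ) := FiniteDimensional.proper ℝ _
  have hc := (isCompact_closedBall (0 : W.restrictScalars ℝ) (operatorNorm F)).image
    continuous_subtype_val
  refine hc.totallyBounded.subset ?_
  rintro _ ⟨x, hx, rfl⟩
  refine ⟨⟨F x, ⟨x, rfl⟩⟩, ?_, rfl⟩
  rw [mem_closedBall_zero_iff] at hx ⊢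
  refine (norm_apply_le_operatorNorm F x).trans ?_
  exact mul_le_of_le_one_right (operatorNorm_nonneg F) hx

theorem IsFiniteRankLimit.totallyBounded_image [NormedSpace ℝ E] [IsScalarTower ℝ ℍᵐᵒᵖ E]
    {S : E →L[ℍᵐᵒᵖ] E} (hS : IsFiniteRankLimit S) :
    TotallyBounded (S '' Metric.closedBall 0 1) := by
  rw [Metric.totallyBounded_iff]
  intro ε hε
  obtain ⟨F, hF, hlt⟩ := hS (ε / 2) (by positivity)
  obtain ⟨t, ht, hsub⟩ := Metric.totallyBounded_iff.1 (totallyBounded_image_of_finiteRank F hF)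
    (ε / 2) (by positivity)
  refine ⟨t, ht, ?_⟩
  rintro _ ⟨x, hx, rfl⟩
  obtain ⟨y, hy, hxy⟩ := Set.mem_iUnion₂.1 (hsub ⟨x, hx, rfl⟩)
  refine Set.mem_iUnion₂.2 ⟨y, hy, ?_⟩
  rw [Metric.mem_ball] at hxy ⊢
  have h1 : dist (S x) (F x) ≤ ε / 2 := by
    rw [dist_eq_norm, ← sub_apply]
    refine (norm_apply_le_operatorNorm _ x).trans ?_
    rw [mem_closedBall_zero_iff] at hx
    exact (mul_le_of_le_one_right (operatorNorm_nonneg _) hx).trans hlt.le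
  linarith [dist_triangle (S x) (F x) y]

theorem norm_sub_sq' (x y : E) :
    ‖x - y‖ ^ 2 = ‖x‖ ^ 2 - 2 * (inner ℍ y x : ℍ).re + ‖y‖ ^ 2 := by
  have h : (inner ℍ x y : ℍ).re = (inner ℍ y x : ℍ).re := by
    rw [← star_inner, Quaternion.re_star]
  rw [← inner_self_re, inner_sub_left', inner_sub_right', inner_sub_right', Quaternion.re_sub,
    Quaternion.re_sub, Quaternion.re_sub, inner_self_re, inner_self_re, h]
  ring

/-- A positive norm limit of finite rank operators attains its norm at an eigenvector. -/
theorem IsPositiveOperator.exists_eigenvector [NormedSpace ℝ E] [IsScalarTower ℝ ℍᵐᵒᵖ E]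
    [CompleteSpace E] {S : E →L[ℍᵐᵒᵖ] E} (hS : IsPositiveOperator S)
    (hfin : IsFiniteRankLimit S) :
    ∃ u : E, S u = op (operatorNorm S : ℍ) • u ∧ ‖u‖ ^ 2 = operatorNorm S := by
  set l := operatorNorm S with hl
  rcases eq_or_lt_of_le (operatorNorm_nonneg S) with h0 | h0
  · exact ⟨0, by simp, by simp [hl, ← h0]⟩
  have hex : ∀ k : ℕ, ∃ x : E, ‖x‖ = 1 ∧ l - 1 / (k + 1) < (inner ℍ x (S x) : ℍ).re := by
    intro k
    -- The maximum with `0` is there because the norm bound from the form needs a nonnegative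
    -- constant.
    set M := max (l - 1 / ((k : ℝ) + 1)) 0 with hM
    have hMl : M < l := max_lt (sub_lt_self _ (by positivity)) h0
    obtain ⟨x, hx⟩ : ∃ x : E, M * ‖x‖ ^ 2 < (inner ℍ x (S x) : ℍ).re := by
      by_contra! hcon
      linarith [hS.operatorNorm_le (le_max_right _ _) hcon]
    have hx0 : 0 < ‖x‖ := by
      rw [norm_pos_iff]
      rintro rfl
      simp [inner_zero_left'] at hx
    refine ⟨op ((‖x‖⁻¹ : ℝ) : ℍ) • x, ?_, lt_of_le_of_lt (le_max_left _ 0) ?_⟩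
    · rw [norm_op_ofReal_smul (by positivity), inv_mul_cancel₀ hx0.ne']
    · rw [map_smul, inner_smul_right', inner_smul_left', Quaternion.star_coe,
        ← Quaternion.coe_commutes, ← mul_assoc, ← Quaternion.coe_mul, Quaternion.coe_mul_eq_smul,
        Quaternion.re_smul, smul_eq_mul, ← hM]
      have : ‖x‖⁻¹ * ‖x‖⁻¹ * (M * ‖x‖ ^ 2) = M := by field_simp
      rw [← this]
      exact mul_lt_mul_of_pos_left hx (by positivity)
  choose x hx1 hx2 using hex
  have hc : IsCompact (closure (S '' Metric.closedBall 0 1)) :=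
    isCompact_iff_totallyBounded_isComplete.2
      ⟨hfin.totallyBounded_image.closure, isClosed_closure.isComplete⟩
  obtain ⟨y, -, φ, hφ, hy⟩ := hc.tendsto_subseq (x := fun k => S (x k)) fun k =>
    subset_closure ⟨x k, by simp [hx1 k], rfl⟩
  -- Near maximizers are near eigenvectors: expanding the square and using `‖S x‖² ≤ l ⟨x, S x⟩`
  -- bounds it by `l (l - ⟨x, S x⟩)`.
  have hbound : ∀ k, ‖S (x k) - op (l : ℍ) • x k‖ ^ 2 ≤ l * (1 / (k + 1)) := by
    intro k
    have h1 := hS.norm_apply_sq_le (inner_apply_re_le S) (x k)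
    rw [norm_sub_sq', norm_op_ofReal_smul h0.le, inner_smul_left', Quaternion.star_coe,
      Quaternion.coe_mul_eq_smul, Quaternion.re_smul, smul_eq_mul, hx1 k]
    nlinarith [hx2 k]
  have hdiff : Tendsto (fun k => S (x k) - op (l : ℍ) • x k) atTop (𝓝 0) := by
    have h1 : Tendsto (fun k : ℕ => l * (1 / ((k : ℝ) + 1))) atTop (𝓝 0) := by
      simpa using tendsto_one_div_add_atTop_nhds_zero_nat.const_mul l
    have h2 : Tendsto (fun k => ‖S (x k) - op (l : ℍ) • x k‖ ^ 2) atTop (𝓝 0) :=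
      squeeze_zero (fun _ => sq_nonneg _) hbound h1
    rw [tendsto_zero_iff_norm_tendsto_zero]
    simpa [Real.sqrt_sq (norm_nonneg _)] using h2.sqrt
  have hy' : Tendsto (fun k => op (l : ℍ) • x (φ k)) atTop (𝓝 y) := by
    have := hy.sub (hdiff.comp hφ.tendsto_atTop)
    simpa using this
  have hlc : Continuous fun z : E => op (l : ℍ) • z :=
    AddMonoidHomClass.continuous_of_bound
      (DistribSMul.toAddMonoidHom E (op (l : ℍ))) l
      fun z => (norm_op_ofReal_smul h0.le z).le
  have hSy : S y = op (l : ℍ) • y := by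
    have h1 := (S.continuous.tendsto y).comp hy'
    have h2 := (hlc.tendsto y).comp hy
    refine tendsto_nhds_unique h1 (h2.congr fun k => ?_)
    simp
  have hny : ‖y‖ = l := by
    refine tendsto_nhds_unique hy'.norm (tendsto_const_nhds.congr fun k => ?_)
    rw [norm_op_ofReal_smul h0.le, hx1, mul_one]
  -- The limit `y` of `x_k l` has norm `l`. Division by `√l` gives `‖u‖² = l`, so that `rankOne u`
  -- is `l` times the projection onto the eigenline.
  refine ⟨op (((√l)⁻¹ : ℝ) : ℍ) • y, ?_, ?_⟩
  · rw [map_smul, hSy, smul_smul, smul_smul, ← op_mul, ← op_mul, Quaternion.coe_commutes]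
  · rw [norm_op_ofReal_smul (by positivity), hny, mul_pow, inv_pow, Real.sq_sqrt h0.le, sq l,
      inv_mul_cancel_left₀ h0.ne']

end Greedy

/-! ### Spectral decomposition and singular numbers. -/

section Spectral

set_option linter.unusedSectionVars false

open QuaternionicInnerProductSpace

variable {E : Type*} [NormedAddCommGroup E] [Module ℍᵐᵒᵖ E] [Inner ℍ E]
  [QuaternionicInnerProductSpace E]

theorem inner_sum_right' (x : E) (s : Finset ℕ) (y : ℕ → E) :
    (inner ℍ x (∑ k ∈ s, y k) : ℍ) = ∑ k ∈ s, (inner ℍ x (y k) : ℍ) :=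
  map_sum (innerAddHom x) y s

theorem norm_sq_sum_smul {u : ℕ → E} (hu : ∀ m n, m ≠ n → (inner ℍ (u m) (u n) : ℍ) = 0)
    (s : Finset ℕ) (q : ℕ → ℍ) :
    ‖∑ k ∈ s, op (q k) • u k‖ ^ 2 = ∑ k ∈ s, ‖q k‖ ^ 2 * ‖u k‖ ^ 2 := by
  have hortho : ∀ (s : Finset ℕ) (a : ℕ), a ∉ s →
      (inner ℍ (op (q a) • u a) (∑ k ∈ s, op (q k) • u k) : ℍ) = 0 := by
    intro s a ha
    rw [inner_sum_right']
    refine Finset.sum_eq_zero fun k hk => ?_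
    rw [inner_smul_left', inner_smul_right', hu a k (by rintro rfl; exact ha hk), zero_mul,
      mul_zero]
  induction s using Finset.induction_on with
  | empty => simp
  | insert a s ha ih =>
    have h0 := hortho s a ha
    have h0' := congrArg star h0
    rw [star_inner, star_zero] at h0'
    rw [Finset.sum_insert ha, Finset.sum_insert ha, ← inner_self_re, inner_add_right',
      inner_add_left', inner_add_left', h0, h0', add_zero, zero_add, Quaternion.re_add,
      inner_self_re, inner_self_re, ih, norm_op_smul, mul_pow]

/-- The approximation numbers of a diagonal operator are bounded below by its entries. -/
theorem le_singularNumber_of_eigenvectors {T : E →L[ℍᵐᵒᵖ] E} {l : ℕ → ℝ} (hl : Antitone l)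
    {u : ℕ → E} (hu : ∀ m n, m ≠ n → (inner ℍ (u m) (u n) : ℍ) = 0)
    (hnorm : ∀ n, ‖u n‖ ^ 2 = l n) (hT : ∀ n, T (u n) = op (l n : ℍ) • u n) (n : ℕ) :
    l n ≤ singularNumber T n := by
  have hl0 : ∀ k, 0 ≤ l k := fun k => hnorm k ▸ sq_nonneg _
  rcases eq_or_lt_of_le (hl0 n) with h0 | h0
  · rw [← h0]
    exact singularNumber_nonneg T n
  refine le_singularNumber fun F hF => ?_
  -- The `n + 1` vectors `F (u k)` lie in a space of dimension at most `n`. A relation between them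
  -- gives `v ≠ 0` in the span of `u 0, …, u n` with `F v = 0`; there `T` stretches norms by at
  -- least `l n`, so `‖T - F‖ ≥ l n`.
  have hdep : ¬ LinearIndependent ℍᵐᵒᵖ
      fun k : Fin (n + 1) => (F : E →ₗ[ℍᵐᵒᵖ] E).rangeRestrict (u k) := fun h => by
    have h1 := h.cardinal_lift_le_rank
    have h2 := h1.trans (Cardinal.lift_le.2 hF)
    simp only [Cardinal.mk_fin, Cardinal.lift_natCast, Nat.cast_le] at h2
    omega
  obtain ⟨g, hg, j, hj⟩ := Fintype.not_linearIndependent_iff.1 hdep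
  set q : ℕ → ℍ := fun k => if h : k < n + 1 then unop (g ⟨k, h⟩) else 0 with hq
  have hqk : ∀ k : Fin (n + 1), op (q k) = g k := fun k => by
    simp only [hq, dif_pos k.2, Fin.eta, op_unop]
  set v : E := ∑ k ∈ Finset.range (n + 1), op (q k) • u k with hv
  have hFv : F v = 0 := by
    have := congrArg Subtype.val hg
    rw [hv, map_sum, Finset.sum_range]
    simpa [hqk] using this
  have hvn : ‖v‖ ^ 2 = ∑ k ∈ Finset.range (n + 1), ‖q k‖ ^ 2 * l k := by
    rw [hv, norm_sq_sum_smul hu]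
    simp only [hnorm]
  have hTv : T v = ∑ k ∈ Finset.range (n + 1), op ((l k : ℍ) * q k) • u k := by
    rw [hv, map_sum]
    refine Finset.sum_congr rfl fun k _ => ?_
    rw [map_smul, hT, smul_smul, ← op_mul]
  have hTn : (l n * ‖v‖) ^ 2 ≤ ‖T v‖ ^ 2 := by
    rw [hTv, norm_sq_sum_smul hu, mul_pow, hvn, Finset.mul_sum]
    refine Finset.sum_le_sum fun k hk => ?_
    rw [norm_mul, Quaternion.norm_coe, Real.norm_of_nonneg (hl0 k), mul_pow, hnorm, mul_assoc]
    exact mul_le_mul_of_nonneg_right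
      (pow_le_pow_left₀ h0.le (hl (Nat.lt_succ_iff.1 (Finset.mem_range.1 hk))) 2)
      (mul_nonneg (sq_nonneg _) (hl0 k))
  have hv0 : 0 < ‖v‖ := by
    have : 0 < ‖v‖ ^ 2 := by
      rw [hvn]
      refine Finset.sum_pos' (fun k _ => mul_nonneg (sq_nonneg _) (hl0 k))
        ⟨j, Finset.mem_range.2 j.2, mul_pos ?_ ?_⟩
      · have : q j ≠ 0 := fun h => hj (by rw [← hqk, h, op_zero])
        positivity
      · exact h0.trans_le (hl (Nat.lt_succ_iff.1 j.2))
    refine lt_of_le_of_ne (norm_nonneg v) fun h => ?_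
    simp [← h] at this
  have h1 : l n * ‖v‖ ≤ ‖T v‖ :=
    abs_le_of_sq_le_sq' hTn (norm_nonneg _) |>.2
  have h2 := norm_apply_le_operatorNorm (T - F) v
  rw [sub_apply, hFv, sub_zero] at h2
  exact le_of_mul_le_mul_right (h1.trans h2) hv0

/-- The spectral theorem for positive norm limits of finite rank operators, in terms of the
quadratic form and of the singular numbers. -/
theorem IsPositiveOperator.exists_hasSum_of_tendsto [NormedSpace ℝ E] [IsScalarTower ℝ ℍᵐᵒᵖ E]
    [CompleteSpace E] {T : E →L[ℍᵐᵒᵖ] E} (hT : IsPositiveOperator T)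
    (h0 : Tendsto (singularNumber T) atTop (𝓝 0)) :
    ∃ u : ℕ → E, (∀ n, ‖u n‖ ^ 2 = singularNumber T n) ∧
      ∀ x, HasSum (fun n => ‖(inner ℍ (u n) x : ℍ)‖ ^ 2) (inner ℍ x (T x) : ℍ).re := by
  have hex : ∀ S : E →L[ℍᵐᵒᵖ] E, IsPositiveOperator S ∧ IsFiniteRankLimit S →
      ∃ u : E, S u = op (operatorNorm S : ℍ) • u ∧ ‖u‖ ^ 2 = operatorNorm S :=
    fun S hS => hS.1.exists_eigenvector hS.2
  choose! e he1 he2 using hex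
  -- `G n` is the remainder after `n` top eigenvectors have been removed.
  set G : ℕ → (E →L[ℍᵐᵒᵖ] E) := fun n => Nat.rec T (fun _ S => S - rankOne (e S)) n with hG
  set l : ℕ → ℝ := fun n => operatorNorm (G n) with hl
  set u : ℕ → E := fun n => e (G n) with hu
  have hG0 : G 0 = T := rfl
  have hGs : ∀ n, G (n + 1) = G n - rankOne (u n) := fun _ => rfl
  have hl0 : ∀ n, 0 ≤ l n := fun n => operatorNorm_nonneg _
  have hgood : ∀ n, IsPositiveOperator (G n) ∧ IsFiniteRankLimit (G n) := by
    intro n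
    induction n with
    | zero => exact ⟨hT, isFiniteRankLimit_of_tendsto h0⟩
    | succ n ih =>
      refine ⟨ih.1.sub_rankOne fun x => ?_, ih.2.sub_rankOne _⟩
      -- Since `G n (u n) = u n l` and `‖u n‖² = l`, this reads `l² |⟨u n, x⟩|² ≤ l² ⟨x, G n x⟩`,
      -- which keeps the next remainder positive.
      have h1 := ih.1.norm_inner_sq_le x (u n)
      have e1 : G n (u n) = op (l n : ℍ) • u n := he1 _ ih
      have e2 : ‖u n‖ ^ 2 = l n := he2 _ ih
      rw [e1, inner_smul_right', inner_smul_right', norm_mul, Quaternion.norm_coe,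
        Real.norm_of_nonneg (hl0 n), ← Quaternion.coe_commutes, Quaternion.coe_mul_eq_smul,
        Quaternion.re_smul, inner_self_re, e2, smul_eq_mul, norm_inner_comm, mul_pow] at h1
      rcases eq_or_lt_of_le (hl0 n) with h | h
      · have : u n = 0 := by
          rw [← h] at e2
          simpa using e2
        change ‖(inner ℍ (u n) x : ℍ)‖ ^ 2 ≤ _
        rw [this, inner_zero_left']
        simpa using (ih.1 x).2
      · have : l n * l n * ‖(inner ℍ (u n) x : ℍ)‖ ^ 2
            ≤ l n * l n * (inner ℍ x (G n x) : ℍ).re := by nlinarith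
        exact le_of_mul_le_mul_left this (by positivity)
  have hGu : ∀ n, G n (u n) = op (l n : ℍ) • u n := fun n => he1 _ (hgood n)
  have hun : ∀ n, ‖u n‖ ^ 2 = l n := fun n => he2 _ (hgood n)
  have hsum : ∀ n, T = G n + ∑ k ∈ Finset.range n, rankOne (u k) := by
    intro n
    induction n with
    | zero => simp [hG0]
    | succ n ih =>
      rw [Finset.sum_range_succ, hGs]
      conv_lhs => rw [ih]
      abel
  have hform : ∀ n x, (inner ℍ x (T x) : ℍ).re
      = (inner ℍ x (G n x) : ℍ).re + ∑ k ∈ Finset.range n, ‖(inner ℍ (u k) x : ℍ)‖ ^ 2 := by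
    intro n x
    conv_lhs => rw [hsum n]
    rw [add_apply, inner_add_right', Quaternion.re_add, inner_sum_rankOne_re]
  have hanti : Antitone l := by
    refine antitone_nat_of_succ_le fun n => ?_
    refine (hgood (n + 1)).1.operatorNorm_le (hl0 n) fun x => ?_
    refine le_trans ?_ (inner_apply_re_le (G n) x)
    rw [hGs, sub_apply, inner_sub_right', Quaternion.re_sub, inner_rankOne_self,
      Quaternion.re_coe]
    linarith [sq_nonneg ‖(inner ℍ (u n) x : ℍ)‖]
  have hzero : ∀ n, l n = 0 → u n = 0 := fun n h => by
    have := hun n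
    rw [h] at this
    simpa using this
  -- For the symmetric operator `G n`, its kernel is orthogonal to an eigenvector with nonzero
  -- eigenvalue; for eigenvalue `0` the vector `u n` itself vanishes.
  have hinner : ∀ m n, G n (u m) = 0 → (inner ℍ (u n) (u m) : ℍ) = 0 := by
    intro m n h
    rcases eq_or_ne (l n) 0 with h' | h'
    · rw [hzero n h', inner_zero_left']
    · have h1 := (hgood n).1.inner_apply_left (u n) (u m)
      rw [h, inner_zero_right', hGu, inner_smul_left', Quaternion.star_coe] at h1
      exact (mul_eq_zero.1 h1).resolve_left
        fun hc => h' (Quaternion.coe_inj.1 (hc.trans Quaternion.coe_zero.symm))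
  -- Subtracting `rankOne (u m)` cancels `G m` on `u m`; the later subtractions do not affect `u m`,
  -- by `hinner`.
  have hkill : ∀ m n, m < n → G n (u m) = 0 := by
    intro m n h
    induction n, h using Nat.le_induction with
    | base => rw [hGs, sub_apply, hGu, rankOne_apply, inner_self, hun, sub_self]
    | succ n _ ih =>
      rw [hGs, sub_apply, ih, rankOne_apply, hinner m n ih, op_zero, zero_smul, sub_zero]
  have hortho : ∀ m n, m ≠ n → (inner ℍ (u m) (u n) : ℍ) = 0 := by
    intro m n h
    rcases lt_or_gt_of_ne h with h | h
    · rw [← star_inner, hinner m n (hkill m n h), star_zero]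
    · exact hinner n m (hkill n m h)
  have hTu : ∀ n, T (u n) = op (l n : ℍ) • u n := by
    intro n
    conv_lhs => rw [hsum n]
    rw [add_apply, hGu, add_eq_left, sum_apply]
    refine Finset.sum_eq_zero fun k hk => ?_
    rw [rankOne_apply, hortho k n (Finset.mem_range.1 hk).ne, op_zero, zero_smul]
  have hs : ∀ n, l n = singularNumber T n := by
    intro n
    refine le_antisymm (le_singularNumber_of_eigenvectors hanti hortho hun hTu n) ?_
    -- The first `n` rank one terms are a competitor of rank at most `n` with error exactly `G n`.
    refine (singularNumber_le (rank_sum_rankOne_le u n)).trans (le_of_eq ?_)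
    rw [hl]
    congr 1
    rw [sub_eq_iff_eq_add]
    exact hsum n
  refine ⟨u, fun n => (hun n).trans (hs n), fun x => ?_⟩
  rw [hasSum_iff_tendsto_nat_of_nonneg fun n => sq_nonneg _]
  have hlim : Tendsto (fun n => l n * ‖x‖ ^ 2) atTop (𝓝 0) := by
    simpa [funext hs] using h0.mul_const (‖x‖ ^ 2)
  have h1 : Tendsto (fun n => (inner ℍ x (G n x) : ℍ).re) atTop (𝓝 0) :=
    squeeze_zero (fun n => ((hgood n).1 x).2) (fun n => inner_apply_re_le (G n) x) hlim
  have h2 := h1.const_sub (inner ℍ x (T x) : ℍ).re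
  rw [sub_zero] at h2
  refine h2.congr fun n => ?_
  rw [hform n x]
  ring

theorem IsOrthonormalSeq.norm_eq_one {e : ℕ → E} (he : IsOrthonormalSeq e) (n : ℕ) :
    ‖e n‖ = 1 := by
  have h := inner_self_re (e n)
  rw [he, if_pos rfl, Quaternion.re_one] at h
  nlinarith [norm_nonneg (e n)]

theorem continuous_inner_right (x : E) : Continuous fun y : E => (inner ℍ x y : ℍ) :=
  AddMonoidHomClass.continuous_of_bound (innerAddHom x) ‖x‖ fun y => norm_inner_le_norm' x y

/-- A singular value decomposition of a positive operator is a spectral decomposition. -/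
theorem IsPositiveOperator.exists_hasSum_of_isSingularValueSeq {T : E →L[ℍᵐᵒᵖ] E}
    (hT : IsPositiveOperator T) {s : ℕ → ℝ} (hs : IsSingularValueSeq T s) :
    ∃ u : ℕ → E, (∀ n, ‖u n‖ ^ 2 = s n) ∧
      ∀ x, HasSum (fun n => ‖(inner ℍ (u n) x : ℍ)‖ ^ 2) (inner ℍ x (T x) : ℍ).re := by
  obtain ⟨hs0, -, e, σ, he, hσ, hsum⟩ := hs
  have hTe : ∀ n, T (e n) = op (s n : ℍ) • σ n := by
    intro n
    have h := hsum (e n)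
    refine h.unique ?_
    convert hasSum_single n fun m hm => ?_ using 1
    · rw [he, if_pos rfl, mul_one]
    · rw [he, if_neg hm, mul_zero, op_zero, zero_smul]
  -- Symmetry of `T` exchanges the roles of `e` and `σ`, because `⟨σ n, T x⟩ = s n ⟨e n, x⟩`.
  have hTσ : ∀ n, T (σ n) = op (s n : ℍ) • e n := by
    intro n
    have hx : ∀ x : E, (inner ℍ x (T (σ n) - op (s n : ℍ) • e n) : ℍ) = 0 := by
      intro x
      have h1 : HasSum (fun m => (inner ℍ (σ n) (op ((s m : ℍ) * inner ℍ (e m) x) • σ m) : ℍ))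
          (inner ℍ (σ n) (T x)) :=
        (hsum x).map (innerAddHom (σ n)) (continuous_inner_right (σ n))
      have h2 : (inner ℍ (σ n) (T x) : ℍ) = (s n : ℍ) * inner ℍ (e n) x := by
        refine h1.unique ?_
        convert hasSum_single n fun m hm => ?_ using 1
        · rw [inner_smul_right', hσ, if_pos rfl, one_mul]
        · rw [inner_smul_right', hσ, if_neg hm.symm, zero_mul]
      rw [inner_sub_right', ← hT.star_inner_apply, h2, inner_smul_right', star_mul,
        star_inner, Quaternion.star_coe, sub_self]
    have := inner_self_re (T (σ n) - op (s n : ℍ) • e n)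
    rw [hx, Quaternion.re_zero] at this
    rw [← sub_eq_zero, ← norm_eq_zero]
    exact pow_eq_zero_iff two_ne_zero |>.1 this.symm
  -- The difference `w` satisfies `T w = -(w s n)`, which positivity allows only for `w = 0` when `s
  -- n > 0`.
  have heσ : ∀ n, op (s n : ℍ) • σ n = op (s n : ℍ) • e n := by
    intro n
    set w : E := op (s n : ℍ) • σ n - op (s n : ℍ) • e n with hw
    have hTw : T w = -(op (s n : ℍ) • w) := by
      rw [hw, map_sub, map_smul, map_smul, hTe, hTσ, smul_sub, neg_sub]
    have h1 := (hT w).2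
    rw [hTw, inner_neg_right', inner_smul_right', ← Quaternion.coe_commutes,
      Quaternion.coe_mul_eq_smul, Quaternion.re_neg, Quaternion.re_smul, inner_self_re,
      smul_eq_mul] at h1
    rcases eq_or_lt_of_le (hs0 n) with h | h
    · rw [← h]
      simp
    · have h2 : ‖w‖ ^ 2 ≤ 0 := by
        by_contra! hcon
        nlinarith
      have h3 : ‖w‖ = 0 := pow_eq_zero_iff two_ne_zero |>.1 (le_antisymm h2 (sq_nonneg _))
      exact sub_eq_zero.1 (norm_eq_zero.1 h3)
  refine ⟨fun n => op (√(s n) : ℍ) • e n, fun n => ?_, fun x => ?_⟩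
  · rw [norm_op_ofReal_smul (Real.sqrt_nonneg _), he.norm_eq_one, mul_one, Real.sq_sqrt (hs0 n)]
  · have h1 : HasSum (fun m => (inner ℍ x (op ((s m : ℍ) * inner ℍ (e m) x) • σ m) : ℍ))
        (inner ℍ x (T x)) := (hsum x).map (innerAddHom x) (continuous_inner_right x)
    have h2 : HasSum (fun m => (inner ℍ x (op ((s m : ℍ) * inner ℍ (e m) x) • σ m) : ℍ).re)
        (inner ℍ x (T x) : ℍ).re :=
      h1.map (⟨⟨QuaternionAlgebra.re, rfl⟩, fun _ _ => rfl⟩ : ℍ →+ ℝ) Quaternion.continuous_re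
    convert h2 using 2 with n
    rw [op_mul, mul_smul, heσ, inner_smul_right', inner_smul_right', inner_smul_left', norm_mul,
      Quaternion.star_coe, Quaternion.norm_coe, Real.norm_of_nonneg (Real.sqrt_nonneg _), mul_pow,
      Real.sq_sqrt (hs0 n), ← Quaternion.coe_commutes, mul_assoc, ← star_inner (e n) x,
      Quaternion.star_mul_self, ← Quaternion.coe_mul, Quaternion.re_coe,
      Quaternion.normSq_eq_norm_mul_self, sq]

end Spectral

section

/-! ### Slices -/

theorem imaginaryUnits_mul_self {J : ℍ} (hJ : J ∈ imaginaryUnits) : J * J = -1 := by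
  have h := norm_sq_eq_components J
  rw [hJ.2, hJ.1] at h
  ext <;> simp [hJ.1] <;> nlinarith

theorem neg_mem_imaginaryUnits {J : ℍ} (hJ : J ∈ imaginaryUnits) : -J ∈ imaginaryUnits :=
  ⟨by simp [hJ.1], by rw [norm_neg, hJ.2]⟩

/-- The embedding of `ℂ` onto the slice `ℂ_J`, as a homomorphism of algebras. -/
def sliceHom (J : imaginaryUnits) : ℂ →ₐ[ℝ] ℍ :=
  Complex.lift ⟨J, imaginaryUnits_mul_self J.2⟩

variable {J : imaginaryUnits}

theorem sliceHom_apply (z : ℂ) : sliceHom J z = slicePoint J z := by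
  rw [sliceHom, Complex.lift_apply, Complex.liftAux_apply, slicePoint, ← Quaternion.coe_commutes,
    Quaternion.coe_mul_eq_smul]
  rfl

theorem slicePoint_mul (z w : ℂ) : slicePoint J (z * w) = slicePoint J z * slicePoint J w := by
  simp only [← sliceHom_apply, map_mul]

theorem slicePoint_pow (z : ℂ) (n : ℕ) : slicePoint J (z ^ n) = slicePoint J z ^ n := by
  simp only [← sliceHom_apply, map_pow]

theorem slicePoint_one : slicePoint J 1 = 1 := by
  rw [← sliceHom_apply, map_one]

theorem slicePoint_ofReal (r : ℝ) : slicePoint J r = (r : ℍ) := by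
  simp [slicePoint]

theorem star_slicePoint (z : ℂ) : star (slicePoint J z) = slicePoint J (star z) := by
  have := J.2.1
  ext <;> simp [slicePoint, this, mul_comm]

theorem norm_slicePoint (z : ℂ) : ‖slicePoint J z‖ = ‖z‖ := by
  have h := norm_sq_eq_components (J : ℍ)
  rw [J.2.2, J.2.1] at h
  rw [← sq_eq_sq₀ (norm_nonneg _) (norm_nonneg _), norm_sq_eq_components, Complex.sq_norm,
    Complex.normSq_apply]
  simp [slicePoint, J.2.1]
  nlinarith

theorem slicePoint_mem_unitBall {z : ℂ} : slicePoint J z ∈ unitBall ↔ z ∈ Metric.ball (0 : ℂ) 1 := by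
  rw [unitBall, mem_ball_zero_iff, mem_ball_zero_iff, norm_slicePoint]

/-- The slice embedding as a real continuous linear map. -/
def sliceCLM (J : imaginaryUnits) : ℂ →L[ℝ] ℍ :=
  LinearMap.toContinuousLinearMap (sliceHom J).toLinearMap

theorem sliceCLM_apply (z : ℂ) : sliceCLM J z = slicePoint J z := sliceHom_apply z

theorem continuous_slicePoint : Continuous (slicePoint J) :=
  (sliceCLM J).continuous.congr sliceCLM_apply

theorem mem_profile_unitBall {z : ℂ} : z ∈ profile unitBall ↔ z ∈ Metric.ball (0 : ℂ) 1 := by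
  constructor
  · rintro ⟨J, hJ, h⟩
    exact (slicePoint_mem_unitBall (J := ⟨J, hJ⟩)).1 h
  · intro h
    have hI : (⟨0, 1, 0, 0⟩ : ℍ) ∈ imaginaryUnits := by
      refine ⟨rfl, ?_⟩
      have := norm_sq_eq_components (⟨0, 1, 0, 0⟩ : ℍ)
      simp only [ne_eq, OfNat.ofNat_ne_zero, not_false_eq_true, zero_pow, one_pow, zero_add,
        add_zero] at this
      exact (pow_eq_one_iff_of_nonneg (norm_nonneg _) two_ne_zero).1 this
    exact ⟨_, hI, (slicePoint_mem_unitBall (J := ⟨_, hI⟩)).2 h⟩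

/-- Every quaternion lies on a slice. -/
theorem exists_slicePoint_eq (q : ℍ) : ∃ (J : imaginaryUnits) (z : ℂ), slicePoint J z = q := by
  rcases eq_or_ne q.im 0 with h | h
  · obtain ⟨J, hJ, -⟩ := mem_profile_unitBall.2 (Metric.mem_ball_self one_pos)
    refine ⟨⟨J, hJ⟩, (q.re : ℂ), ?_⟩
    rw [slicePoint_ofReal]
    conv_rhs => rw [← Quaternion.re_add_im q, h, add_zero]
  · have h0 : ‖q.im‖ ≠ 0 := norm_ne_zero_iff.2 h
    refine ⟨⟨q.im * ((‖q.im‖⁻¹ : ℝ) : ℍ), ?_, ?_⟩, ⟨q.re, ‖q.im‖⟩, ?_⟩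
    · rw [← Quaternion.coe_commutes, Quaternion.coe_mul_eq_smul, Quaternion.re_smul,
        Quaternion.re_im, smul_zero]
    · rw [norm_mul, Quaternion.norm_coe, norm_inv, norm_norm, mul_inv_cancel₀ h0]
    · rw [slicePoint, mul_assoc, ← Quaternion.coe_mul, inv_mul_cancel₀ h0, Quaternion.coe_one,
        mul_one, Quaternion.re_add_im]

/-! ### The left complex structure of a slice -/

/-- The quaternions as a complex Banach space, by left multiplication with the slice `ℂ_J`. -/
def LeftSlice (_ : imaginaryUnits) : Type := ℍ

instance : NormedAddCommGroup (LeftSlice J) := inferInstanceAs (NormedAddCommGroup ℍ)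

instance : CompleteSpace (LeftSlice J) := inferInstanceAs (CompleteSpace ℍ)

instance : Module ℂ (LeftSlice J) := Module.compHom ℍ (sliceHom J).toRingHom

/-- The identity map onto the slice structure. -/
def toLeftSlice (J : imaginaryUnits) : ℍ ≃+ LeftSlice J := AddEquiv.refl ℍ

theorem norm_toLeftSlice (q : ℍ) : ‖toLeftSlice J q‖ = ‖q‖ := rfl

theorem continuous_toLeftSlice : Continuous (toLeftSlice J) := continuous_id

theorem continuous_toLeftSlice_symm : Continuous (toLeftSlice J).symm := continuous_id

theorem smul_toLeftSlice (z : ℂ) (q : ℍ) :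
    z • toLeftSlice J q = toLeftSlice J (slicePoint J z * q) :=
  congrArg (fun p => toLeftSlice J (p * q)) (sliceHom_apply z)

instance : NormedSpace ℂ (LeftSlice J) where
  norm_smul_le z q := by
    obtain ⟨q, rfl⟩ := (toLeftSlice J).surjective q
    rw [smul_toLeftSlice, norm_toLeftSlice, norm_toLeftSlice, norm_mul, norm_slicePoint]

/-- `h ↦ h D`, for `h` in the slice `ℂ_J`. -/
def sliceDeriv (J : imaginaryUnits) (D : ℍ) : ℂ →L[ℝ] ℍ := (mulRight D).comp (sliceCLM J)

theorem sliceDeriv_apply (D : ℍ) (z : ℂ) : sliceDeriv J D z = slicePoint J z * D := by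
  rw [← sliceCLM_apply]
  rfl

theorem sliceDeriv_one (D : ℍ) : sliceDeriv J D 1 = D := by
  rw [sliceDeriv_apply, slicePoint_one, one_mul]

theorem sliceDeriv_I (D : ℍ) : sliceDeriv J D Complex.I = J * D := by
  rw [sliceDeriv_apply]
  simp [slicePoint]

/-- A real derivative of the form `h ↦ h D` is a complex derivative for the left slice structure, as
both say the same little-o. This gives access to complex analysis for `ℍ`-valued functions. -/
theorem hasFDerivAt_sliceDeriv_iff {F : ℂ → ℍ} {D : ℍ} {z : ℂ} :
    HasFDerivAt F (sliceDeriv J D) z ↔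
      HasDerivAt (fun w => toLeftSlice J (F w)) (toLeftSlice J D) z := by
  rw [hasFDerivAt_iff_isLittleO, hasDerivAt_iff_isLittleO, ← Asymptotics.isLittleO_norm_left,
    ← Asymptotics.isLittleO_norm_left (E' := LeftSlice J)]
  simp only [smul_toLeftSlice, ← map_sub, norm_toLeftSlice, sliceDeriv_apply]

/-- By `J² = -1` the Cauchy-Riemann system for `a`, `b` gives `∂₁ F = J ∂₀ F` for `F = a + J b`;
hence `D = ∂₀ F`. -/
theorem IsLeftSliceHyperholomorphic.exists_hasFDerivAt {f : ℍ → ℍ}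
    (hf : IsLeftSliceHyperholomorphic unitBall f) {z : ℂ} (hz : z ∈ Metric.ball (0 : ℂ) 1) :
    ∃ D : ℍ, HasFDerivAt (fun w => f (slicePoint J w)) (sliceDeriv J D) z := by
  obtain ⟨-, a, b, hab, -, hd, hcr⟩ := hf
  have hzp := mem_profile_unitBall.2 hz
  have hF : HasFDerivAt (fun w => a w + J * b w)
      (fderiv ℝ a z + (ContinuousLinearMap.mul ℝ ℍ (J : ℍ)).comp (fderiv ℝ b z)) z :=
    (hd z hzp).1.hasFDerivAt.add
      ((ContinuousLinearMap.mul ℝ ℍ (J : ℍ)).hasFDerivAt.comp z (hd z hzp).2.hasFDerivAt)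
  have heq : (fun w => f (slicePoint J w)) =ᶠ[𝓝 z] fun w => a w + J * b w := by
    filter_upwards [Metric.isOpen_ball.mem_nhds hz] with w hw
    exact hab J J.2 w (slicePoint_mem_unitBall.2 hw)
  refine ⟨fderiv ℝ a z 1 + J * fderiv ℝ b z 1, (hF.congr_of_eventuallyEq heq).congr_fderiv ?_⟩
  have hJ := imaginaryUnits_mul_self J.2
  obtain ⟨h1, h2⟩ := hcr z hzp
  refine ContinuousLinearMap.coe_injective (Complex.basisOneI.ext fun k => ?_)
  fin_cases k
  · simp [sliceDeriv_one]
  · simp only [Fin.mk_one, Complex.coe_basisOneI, Matrix.cons_val_one, Matrix.cons_val_zero,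
      ContinuousLinearMap.coe_coe, add_apply, ContinuousLinearMap.comp_apply,
      ContinuousLinearMap.mul_apply', sliceDeriv_I, mul_add, ← mul_assoc, hJ, neg_one_mul, h2,
      neg_neg, ← h1]
    simp [add_comm]

/-- Slice hyperholomorphic functions have power series expansions on each slice. -/
theorem IsLeftSliceHyperholomorphic.exists_hasSum {f : ℍ → ℍ}
    (hf : IsLeftSliceHyperholomorphic unitBall f) (J : imaginaryUnits) :
    ∃ c : ℕ → ℍ, ∀ z ∈ Metric.ball (0 : ℂ) 1,
      HasSum (fun n => slicePoint J (z ^ n) * c n) (f (slicePoint J z)) := by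
  set F : ℂ → LeftSlice J := fun w => toLeftSlice J (f (slicePoint J w)) with hF
  have hd : DifferentiableOn ℂ F (Metric.ball 0 1) := fun z hz => by
    obtain ⟨D, hD⟩ := hf.exists_hasFDerivAt (J := J) hz
    exact (hasFDerivAt_sliceDeriv_iff.1 hD).differentiableAt.differentiableWithinAt
  refine ⟨fun n => (toLeftSlice J).symm ((n.factorial : ℂ)⁻¹ • iteratedDeriv n F 0),
    fun z hz => ?_⟩
  have h := (Complex.hasSum_taylorSeries_on_ball hd hz).map (toLeftSlice J).symm
    continuous_toLeftSlice_symm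
  refine h.congr_fun fun n => ?_
  obtain ⟨D, hD⟩ := (toLeftSlice J).surjective ((n.factorial : ℂ)⁻¹ • iteratedDeriv n F 0)
  rw [Function.comp_apply, smul_comm, ← hD, sub_zero, smul_toLeftSlice]
  simp only [← hD, AddEquiv.symm_apply_apply]

/-- By the parity of `a` and `b`, the values at `z` and `z̄` on one slice determine `a z` and `b z`,
hence the values on all slices. -/
theorem IsLeftSliceHyperholomorphic.eq_of_eq_on_slice {f g : ℍ → ℍ}
    (hf : IsLeftSliceHyperholomorphic unitBall f) (hg : IsLeftSliceHyperholomorphic unitBall g)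
    (h : ∀ z ∈ Metric.ball (0 : ℂ) 1, f (slicePoint J z) = g (slicePoint J z)) {q : ℍ}
    (hq : q ∈ unitBall) : f q = g q := by
  obtain ⟨-, a, b, hab, hsym, -, -⟩ := hf
  obtain ⟨-, a', b', hab', hsym', -, -⟩ := hg
  obtain ⟨I, z, rfl⟩ := exists_slicePoint_eq q
  have hz := slicePoint_mem_unitBall.1 hq
  have hz' : star z ∈ Metric.ball (0 : ℂ) 1 := by
    rw [mem_ball_zero_iff] at hz ⊢
    rwa [norm_star]
  have hzp := mem_profile_unitBall.2 hz
  have e1 := h z hz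
  have e2 := h _ hz'
  rw [hab J J.2 z (slicePoint_mem_unitBall.2 hz),
    hab' J J.2 z (slicePoint_mem_unitBall.2 hz)] at e1
  rw [hab J J.2 _ (slicePoint_mem_unitBall.2 hz'),
    hab' J J.2 _ (slicePoint_mem_unitBall.2 hz'), (hsym z hzp).1, (hsym z hzp).2,
    (hsym' z hzp).1, (hsym' z hzp).2] at e2
  rw [mul_neg, mul_neg] at e2
  have ha : a z = a' z := by
    have h2 : (2 : ℝ) • a z = (2 : ℝ) • a' z := by
      calc (2 : ℝ) • a z = (a z + J * b z) + (a z + -(J * b z)) := by rw [two_smul]; abel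
        _ = (a' z + J * b' z) + (a' z + -(J * b' z)) := by rw [e1, e2]
        _ = (2 : ℝ) • a' z := by rw [two_smul]; abel
    exact smul_right_injective ℍ (two_ne_zero (α := ℝ)) h2
  have hb : b z = b' z := by
    have hJ0 : (J : ℍ) ≠ 0 := fun h0 => by simpa [h0] using J.2.2
    rw [ha] at e1
    exact mul_left_cancel₀ hJ0 (add_left_cancel e1)
  rw [hab I I.2 z hq, hab' I I.2 z hq, ha, hb]

end

section

variable {J : imaginaryUnits}

/-! ### Power series -/

/-- The coefficients of power series converging in the unit ball. -/
def IsPowerSeriesCoeff (c : ℕ → ℍ) : Prop :=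
  ∀ r : ℝ, 0 ≤ r → r < 1 → Summable fun n => ‖c n‖ * r ^ n

/-- The sum `∑ qⁿ c_n` in the unit ball, extended by zero. -/
def powerSum (c : ℕ → ℍ) : ℍ → ℍ := unitBall.indicator fun q => ∑' n, q ^ n * c n

variable {c : ℕ → ℍ}

theorem IsPowerSeriesCoeff.summable (hc : IsPowerSeriesCoeff c) {r : ℝ} (h0 : 0 ≤ r) (h1 : r < 1)
    {q : ℕ → ℍ} (hq : ∀ n, ‖q n‖ ≤ r ^ n) : Summable fun n => q n * c n := by
  refine Summable.of_norm_bounded (hc r h0 h1) fun n => ?_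
  rw [norm_mul, mul_comm]
  exact mul_le_mul_of_nonneg_left (hq n) (norm_nonneg _)

theorem powerSum_slicePoint (c : ℕ → ℍ) {z : ℂ} (hz : z ∈ Metric.ball (0 : ℂ) 1) :
    powerSum c (slicePoint J z) = ∑' n, slicePoint J (z ^ n) * c n := by
  rw [powerSum, Set.indicator_of_mem (slicePoint_mem_unitBall.2 hz)]
  simp only [slicePoint_pow]

theorem IsPowerSeriesCoeff.hasSum (hc : IsPowerSeriesCoeff c) {z : ℂ}
    (hz : z ∈ Metric.ball (0 : ℂ) 1) :
    HasSum (fun n => slicePoint J (z ^ n) * c n) (powerSum c (slicePoint J z)) := by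
  rw [powerSum_slicePoint c hz]
  rw [mem_ball_zero_iff] at hz
  exact (hc.summable (norm_nonneg z) hz fun n => by rw [norm_slicePoint, norm_pow]).hasSum

/-- The power series `∑ qⁿ c_n` as a formal multilinear series. -/
def powerFormalSeries (c : ℕ → ℍ) : FormalMultilinearSeries ℝ ℍ ℍ := fun n =>
  (mulRight (c n)).compContinuousMultilinearMap (ContinuousMultilinearMap.mkPiAlgebraFin ℝ n ℍ)

/-- Differentiability in all four real variables does not come from a single slice. Here `qⁿ c_n` is
the diagonal of a real `n`-linear map of norm at most `‖c n‖`, so the series is real analytic with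
radius at least `1`. -/
theorem IsPowerSeriesCoeff.differentiableOn (hc : IsPowerSeriesCoeff c) :
    DifferentiableOn ℝ (powerSum c) unitBall := by
  set p := powerFormalSeries c with hp
  have hnorm : ∀ n, ‖p n‖ ≤ ‖c n‖ := by
    intro n
    refine ContinuousMultilinearMap.opNorm_le_bound (norm_nonneg _) fun m => ?_
    rw [hp, powerFormalSeries, ContinuousLinearMap.compContinuousMultilinearMap_coe,
      Function.comp_apply, ContinuousMultilinearMap.mkPiAlgebraFin_apply, mul_comm]
    change ‖(List.ofFn m).prod * c n‖ ≤ _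
    rw [norm_mul]
    refine mul_le_mul_of_nonneg_right (le_of_eq ?_) (norm_nonneg _)
    change normHom (α := ℍ) _ = _
    rw [map_list_prod, List.map_ofFn, List.prod_ofFn]
    rfl
  have hrad : 1 ≤ p.radius := by
    refine ENNReal.le_of_forall_nnreal_lt fun r hr => ?_
    refine p.le_radius_of_summable_norm ?_
    refine Summable.of_nonneg_of_le (fun n => by positivity) (fun n => ?_)
      (hc r r.2 (by exact_mod_cast hr))
    exact mul_le_mul_of_nonneg_right (hnorm n) (by positivity)
  have hd := (p.hasFPowerSeriesOnBall (one_pos.trans_le hrad)).differentiableOn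
  refine (hd.mono fun q hq => ?_).congr fun q hq => ?_
  · refine Metric.eball_subset_eball hrad ?_
    rw [← ENNReal.ofReal_one, Metric.eball_ofReal]
    exact hq
  · rw [powerSum, Set.indicator_of_mem hq, FormalMultilinearSeries.sum]
    refine tsum_congr fun n => ?_
    rw [hp, powerFormalSeries, ContinuousLinearMap.compContinuousMultilinearMap_coe,
      Function.comp_apply, ContinuousMultilinearMap.mkPiAlgebraFin_apply, List.ofFn_const,
      List.prod_replicate]
    rfl

theorem IsPowerSeriesCoeff.exists_hasFDerivAt (hc : IsPowerSeriesCoeff c) (J : imaginaryUnits)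
    {z : ℂ} (hz : z ∈ Metric.ball (0 : ℂ) 1) :
    ∃ D : ℍ, HasFDerivAt (fun w => powerSum c (slicePoint J w)) (sliceDeriv J D) z := by
  rw [mem_ball_zero_iff] at hz
  obtain ⟨r, hzr, hr1⟩ := exists_between hz
  have hr0 : 0 ≤ r := (norm_nonneg z).trans hzr.le
  have hd : DifferentiableOn ℂ (fun w : ℂ => ∑' n, w ^ n • toLeftSlice J (c n)) (Metric.ball 0 r) := by
    refine Complex.differentiableOn_tsum_of_summable_norm (hc r hr0 hr1)
      (F := fun n w => w ^ n • toLeftSlice J (c n)) (fun n => by fun_prop) Metric.isOpen_ball fun n w hw => ?_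
    rw [smul_toLeftSlice, norm_toLeftSlice, norm_mul, norm_slicePoint, norm_pow, mul_comm]
    rw [mem_ball_zero_iff] at hw
    exact mul_le_mul_of_nonneg_left (pow_le_pow_left₀ (norm_nonneg _) hw.le n) (norm_nonneg _)
  have hzm : Metric.ball (0 : ℂ) r ∈ 𝓝 z := Metric.isOpen_ball.mem_nhds (by simpa using hzr)
  have h1 := (hd.differentiableAt hzm).hasDerivAt
  obtain ⟨D, hD⟩ := (toLeftSlice J).surjective
    (deriv (fun w : ℂ => ∑' n, w ^ n • toLeftSlice J (c n)) z)
  rw [← hD] at h1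
  refine ⟨D, hasFDerivAt_sliceDeriv_iff.2 (h1.congr_of_eventuallyEq ?_)⟩
  filter_upwards [hzm] with w hw
  have hw1 : w ∈ Metric.ball (0 : ℂ) 1 := Metric.ball_subset_ball hr1.le hw
  simp only [smul_toLeftSlice]
  have := (hc.hasSum (J := J) hw1).map (toLeftSlice J) continuous_toLeftSlice
  exact this.tsum_eq.symm

theorem summable_slice_parts (hc : IsPowerSeriesCoeff c) {z : ℂ}
    (hz : z ∈ Metric.ball (0 : ℂ) 1) :
    (Summable fun n => (((z ^ n).re : ℝ) : ℍ) * c n) ∧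
      Summable fun n => (((z ^ n).im : ℝ) : ℍ) * c n := by
  rw [mem_ball_zero_iff] at hz
  constructor
  · refine hc.summable (norm_nonneg z) hz fun n => ?_
    rw [Quaternion.norm_coe, ← norm_pow]
    exact Complex.abs_re_le_norm _
  · refine hc.summable (norm_nonneg z) hz fun n => ?_
    rw [Quaternion.norm_coe, ← norm_pow]
    exact Complex.abs_im_le_norm _

/-- Sums of power series with coefficients on the right are slice hyperholomorphic. -/
theorem IsPowerSeriesCoeff.isLeftSliceHyperholomorphic (hc : IsPowerSeriesCoeff c) :
    IsLeftSliceHyperholomorphic unitBall (powerSum c) := by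
  set a : ℂ → ℍ := fun z => ∑' n, (((z ^ n).re : ℝ) : ℍ) * c n with ha
  set b : ℂ → ℍ := fun z => ∑' n, (((z ^ n).im : ℝ) : ℍ) * c n with hb
  have hab : ∀ J ∈ imaginaryUnits, ∀ z : ℂ, z ∈ Metric.ball (0 : ℂ) 1 →
      powerSum c (slicePoint J z) = a z + J * b z := by
    intro J hJ z hz
    obtain ⟨h1, h2⟩ := summable_slice_parts hc hz
    rw [powerSum_slicePoint (J := ⟨J, hJ⟩) c hz, ha, hb, ← h2.tsum_mul_left,
      ← h1.tsum_add (h2.mul_left _)]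
    refine tsum_congr fun n => ?_
    rw [slicePoint, add_mul, mul_assoc]
  obtain ⟨I, hI, -⟩ := mem_profile_unitBall.2 (Metric.mem_ball_self one_pos)
  have hII := imaginaryUnits_mul_self hI
  -- The components are recovered from the slices of `I` and `-I`: `a = (f_I + f_{-I}) / 2` and `b =
  -- I (f_{-I} - f_I) / 2`.
  have hder : ∀ z ∈ Metric.ball (0 : ℂ) 1, ∃ D D' : ℍ,
      HasFDerivAt a ((1 / 2 : ℝ) • (sliceDeriv ⟨I, hI⟩ D
        + sliceDeriv ⟨-I, neg_mem_imaginaryUnits hI⟩ D')) z ∧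
      HasFDerivAt b ((ContinuousLinearMap.mul ℝ ℍ I).comp ((1 / 2 : ℝ) •
        (sliceDeriv ⟨-I, neg_mem_imaginaryUnits hI⟩ D' - sliceDeriv ⟨I, hI⟩ D))) z := by
    intro z hz
    obtain ⟨D, hD⟩ := hc.exists_hasFDerivAt ⟨I, hI⟩ hz
    obtain ⟨D', hD'⟩ := hc.exists_hasFDerivAt ⟨-I, neg_mem_imaginaryUnits hI⟩ hz
    refine ⟨D, D', ((hD.add hD').const_smul (1 / 2 : ℝ)).congr_of_eventuallyEq ?_,
      ((ContinuousLinearMap.mul ℝ ℍ I).hasFDerivAt.comp z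
        ((hD'.sub hD).const_smul (1 / 2 : ℝ))).congr_of_eventuallyEq ?_⟩
    · filter_upwards [Metric.isOpen_ball.mem_nhds hz] with w hw
      simp only [Pi.add_apply, Pi.smul_apply, hab I hI w hw,
        hab (-I) (neg_mem_imaginaryUnits hI) w hw]
      rw [neg_mul, add_add_add_comm, add_neg_cancel, add_zero, ← two_smul ℝ, smul_smul]
      norm_num
    · filter_upwards [Metric.isOpen_ball.mem_nhds hz] with w hw
      simp only [Function.comp_apply, Pi.sub_apply, Pi.smul_apply, hab I hI w hw,
        hab (-I) (neg_mem_imaginaryUnits hI) w hw, ContinuousLinearMap.mul_apply']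
      rw [neg_mul, add_sub_add_left_eq_sub, ← neg_add', ← two_smul ℝ, smul_neg, smul_smul]
      norm_num
      rw [← mul_assoc, hII, neg_one_mul, neg_neg]
  refine ⟨hc.differentiableOn, a, b, fun J hJ z hz => hab J hJ z
    ((slicePoint_mem_unitBall (J := ⟨J, hJ⟩)).1 hz), fun z _ => ⟨?_, ?_⟩, fun z hz => ?_,
    fun z hz => ?_⟩
  · refine tsum_congr fun n => ?_
    rw [← star_pow, Complex.star_def, Complex.conj_re]
  · rw [hb, ← tsum_neg]
    refine tsum_congr fun n => ?_
    rw [← star_pow, Complex.star_def, Complex.conj_im, Quaternion.coe_neg, neg_mul]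
  · obtain ⟨D, D', h1, h2⟩ := hder z (mem_profile_unitBall.1 hz)
    exact ⟨h1.differentiableAt, h2.differentiableAt⟩
  · obtain ⟨D, D', h1, h2⟩ := hder z (mem_profile_unitBall.1 hz)
    rw [h1.fderiv, h2.fderiv]
    simp only [smul_apply, add_apply, sub_apply, ContinuousLinearMap.comp_apply,
      ContinuousLinearMap.mul_apply', sliceDeriv_one, sliceDeriv_I, mul_smul_comm, mul_sub,
      ← mul_assoc, mul_neg, neg_mul, hII, one_mul, ← smul_neg]
    constructor
    · congr 1
      abel
    · congr 1
      abel

end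

section

/-! ### The weighted area -/

variable {α : ℝ}

/-- The density of `dA_α` on the unit disc, as a function of the modulus. -/
def radialWeight (α r : ℝ) : ℝ := (α + 1) / Real.pi * (1 - r ^ 2) ^ α

theorem measurable_radialWeight : Measurable fun z : ℂ => radialWeight α ‖z‖ := by
  unfold radialWeight
  fun_prop

theorem radialWeight_nonneg (hα : -1 < α) {r : ℝ} (h0 : 0 ≤ r) (h1 : r ≤ 1) :
    0 ≤ radialWeight α r := by
  have : 0 ≤ 1 - r ^ 2 := by nlinarith
  have : 0 ≤ α + 1 := by linarith
  unfold radialWeight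
  positivity

theorem hasDerivAt_radial (β : ℝ) {r : ℝ} (hr : r ∈ Set.Ioo (0 : ℝ) 1) :
    HasDerivAt (fun r : ℝ => (1 - r ^ 2) ^ (β + 1)) (-(2 * (β + 1)) * (r * (1 - r ^ 2) ^ β)) r := by
  have h1 : 0 < 1 - r ^ 2 := by nlinarith [hr.1, hr.2]
  have h2 : HasDerivAt (fun r : ℝ => 1 - r ^ 2) (-(2 * r)) r := by
    simpa using (hasDerivAt_pow 2 r).const_sub 1
  have h3 := h2.rpow_const (p := β + 1) (Or.inl h1.ne')
  convert h3 using 1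
  rw [add_sub_cancel_right]
  ring

theorem continuousOn_radial (hα : -1 < α) :
    ContinuousOn (fun r : ℝ => (1 - r ^ 2) ^ (α + 1)) (Set.Icc 0 1) :=
  ContinuousOn.rpow_const (by fun_prop) fun _ _ => Or.inr (by linarith)

/-- For `α < 0` the integrand blows up at `1`. It is integrable as a nonnegative derivative, up to a
constant, of a function continuous on the closed interval. -/
theorem intervalIntegrable_radial (hα : -1 < α) :
    IntervalIntegrable (fun r : ℝ => r * (1 - r ^ 2) ^ α) volume 0 1 := by
  have h := intervalIntegral.intervalIntegrable_deriv_of_nonneg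
    (g := fun r : ℝ => -(1 - r ^ 2) ^ (α + 1)) (g' := fun r => (2 * (α + 1)) * (r * (1 - r ^ 2) ^ α))
    (a := 0) (b := 1) ?_ ?_ ?_
  · have h2 : (2 * (α + 1)) ≠ 0 := by
      have : 0 < α + 1 := by linarith
      positivity
    convert h.const_mul (2 * (α + 1))⁻¹ using 2 with r
    rw [inv_mul_cancel_left₀ h2]
  · rw [Set.uIcc_of_le zero_le_one]
    exact (continuousOn_radial hα).neg
  · rintro r hr
    rw [min_eq_left zero_le_one, max_eq_right zero_le_one] at hr
    exact (hasDerivAt_radial α hr).neg.congr_deriv (by ring)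
  · rintro r hr
    rw [min_eq_left zero_le_one, max_eq_right zero_le_one] at hr
    have : 0 < α + 1 := by linarith
    have : 0 < 1 - r ^ 2 := by nlinarith [hr.1, hr.2]
    have := hr.1
    positivity

theorem intervalIntegrable_radial_mul (hα : -1 < α) (n : ℕ) :
    IntervalIntegrable (fun r : ℝ => r ^ (2 * n) * (r * (1 - r ^ 2) ^ α)) volume 0 1 :=
  (intervalIntegrable_radial hα).continuousOn_mul (by fun_prop)

/-- The moments of the radial weight. -/
def radialMoment (α : ℝ) (n : ℕ) : ℝ :=
  ∫ r in (0 : ℝ)..1, 2 * (α + 1) * (r ^ (2 * n) * (r * (1 - r ^ 2) ^ α))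

theorem radialMoment_zero (hα : -1 < α) : radialMoment α 0 = 1 := by
  have h := intervalIntegral.integral_eq_sub_of_hasDerivAt_of_le zero_le_one
    (continuousOn_radial hα).neg (f' := fun r => 2 * (α + 1) * (r ^ (2 * 0) * (r * (1 - r ^ 2) ^ α)))
    (fun r hr => (hasDerivAt_radial α hr).neg.congr_deriv (by ring)) ((intervalIntegrable_radial_mul hα 0).const_mul _)
  rw [radialMoment, h]
  have : α + 1 ≠ 0 := by linarith
  simp [Real.zero_rpow this]

/-- Integrate the derivative of `r^(2n+2) (1 - r²)^(α+1)`, which vanishes at both endpoints. -/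
theorem radialMoment_succ (hα : -1 < α) (n : ℕ) :
    (α + 2 + n) * radialMoment α (n + 1) = (n + 1) * radialMoment α n := by
  have hα0 : α + 1 ≠ 0 := by linarith
  set g : ℕ → ℝ → ℝ := fun n r => r ^ (2 * n) * (r * (1 - r ^ 2) ^ α) with hg
  have hint : ∀ n, IntervalIntegrable (g n) volume 0 1 := intervalIntegrable_radial_mul hα
  have h := intervalIntegral.integral_eq_sub_of_hasDerivAt_of_le zero_le_one
    (f := fun r : ℝ => r ^ (2 * n + 2) * (1 - r ^ 2) ^ (α + 1))
    (f' := fun r => (2 * (n + 1)) * g n r - (2 * (α + 2 + n)) * g (n + 1) r)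
    ((by fun_prop : ContinuousOn (fun r : ℝ => r ^ (2 * n + 2)) (Set.Icc 0 1)).mul
      (continuousOn_radial hα))
    (fun r hr => by
      have h1 : 0 < 1 - r ^ 2 := by nlinarith [hr.1, hr.2]
      refine ((hasDerivAt_pow (2 * n + 2) r).mul (hasDerivAt_radial α hr)).congr_deriv ?_
      simp only [hg]
      rw [Real.rpow_add_one h1.ne', show 2 * n + 2 - 1 = 2 * n + 1 by omega]
      push_cast
      ring)
    (((hint n).const_mul _).sub ((hint (n + 1)).const_mul _))
  rw [intervalIntegral.integral_sub ((hint n).const_mul _) ((hint (n + 1)).const_mul _),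
    intervalIntegral.integral_const_mul, intervalIntegral.integral_const_mul] at h
  simp [Real.zero_rpow hα0] at h
  rw [radialMoment, radialMoment, intervalIntegral.integral_const_mul,
    intervalIntegral.integral_const_mul]
  simp only [hg] at h
  linear_combination (-(α + 1)) * h

theorem radialMoment_pos (hα : -1 < α) (n : ℕ) : 0 < radialMoment α n := by
  induction n with
  | zero => rw [radialMoment_zero hα]; exact one_pos
  | succ n ih =>
    have h := radialMoment_succ hα n
    have h1 : 0 < α + 2 + n := by
      have : (0 : ℝ) ≤ n := n.cast_nonneg
      linarith
    have h2 : 0 < (α + 2 + n) * radialMoment α (n + 1) := by rw [h]; positivity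
    exact (pos_iff_pos_of_mul_pos h2).1 h1

/-- The recursion gives `1 / m_n = (α+2)(α+3)⋯(α+1+n) / n!`, the coefficient of `xⁿ` in `(1 -
x)^(-(α+2))`; the right side is the form in which the binomial series has it. -/
theorem inv_radialMoment (hα : -1 < α) (n : ℕ) :
    (radialMoment α n)⁻¹ = Ring.choose (α + 2 + n - 1) n := by
  have key : ∀ n : ℕ, (n.factorial : ℝ) * (radialMoment α n)⁻¹
      = (ascPochhammer ℝ n).eval (α + 2) := by
    intro n
    induction n with
    | zero => simp [radialMoment_zero hα]
    | succ n ih =>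
      rw [ascPochhammer_succ_eval, ← ih, Nat.factorial_succ]
      have h := radialMoment_succ hα n
      have h1 := (radialMoment_pos hα n).ne'
      have h2 := (radialMoment_pos hα (n + 1)).ne'
      field_simp
      push_cast
      linear_combination -(n.factorial : ℝ) * h
  have h2 : (n.factorial : ℝ) * Ring.choose (α + 2 + n - 1) n
      = (ascPochhammer ℝ n).eval (α + 2) := by
    have h := Ring.factorial_nsmul_multichoose_eq_ascPochhammer (α + 2) n
    rw [nsmul_eq_mul] at h
    rw [Ring.choose, show α + 2 + (n : ℝ) - 1 - n + 1 = α + 2 by ring, h,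
      Polynomial.ascPochhammer_smeval_eq_eval]
  exact mul_left_cancel₀ (Nat.cast_ne_zero.2 n.factorial_ne_zero) ((key n).trans h2.symm)

theorem hasSum_inv_radialMoment (hα : -1 < α) {x : ℝ} (h0 : 0 ≤ x) (h1 : x < 1) :
    HasSum (fun n => (radialMoment α n)⁻¹ * x ^ n) ((1 - x) ^ (α + 2))⁻¹ := by
  have h := (Real.one_div_one_sub_rpow_hasFPowerSeriesOnBall_zero (α + 2)).hasSum (y := x) (by
    rw [← ENNReal.ofReal_one, Metric.eball_ofReal, mem_ball_zero_iff, Real.norm_of_nonneg h0]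
    exact h1)
  simp only [FormalMultilinearSeries.ofScalars_apply_eq, zero_add, one_div] at h
  refine h.congr_fun fun n => ?_
  rw [inv_radialMoment hα, smul_eq_mul]

end

/-! ### Integration over the disc and orthogonality of the monomials. -/

section

variable {α : ℝ} {J : imaginaryUnits}

/-- The density of `dA_α` with respect to the Lebesgue measure of the plane. -/
def discWeight (α r : ℝ) : ℝ := (Set.Iio 1).indicator (radialWeight α) r

theorem weightedArea_eq : weightedArea α =
    (volume.restrict (Metric.ball 0 1)).withDensity
      fun z => ENNReal.ofReal (radialWeight α ‖z‖) := rfl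

theorem ae_mem_ball : ∀ᵐ z ∂weightedArea α, z ∈ Metric.ball (0 : ℂ) 1 :=
  (withDensity_absolutelyContinuous _ _).ae_le (ae_restrict_mem Metric.isOpen_ball.measurableSet)

theorem integral_weightedArea {F : Type*} [NormedAddCommGroup F] [NormedSpace ℝ F] (hα : -1 < α)
    (h : ℂ → F) : ∫ z, h z ∂weightedArea α = ∫ z, discWeight α ‖z‖ • h z := by
  have hm : AEMeasurable (fun z : ℂ => ENNReal.ofReal (radialWeight α ‖z‖))
      (volume.restrict (Metric.ball 0 1)) := measurable_radialWeight.ennreal_ofReal.aemeasurable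
  rw [weightedArea_eq, integral_withDensity_eq_integral_toReal_smul₀ hm
    (ae_of_all _ fun _ => ENNReal.ofReal_lt_top), ← integral_indicator
    Metric.isOpen_ball.measurableSet]
  refine integral_congr_ae (ae_of_all _ fun z => ?_)
  by_cases hz : z ∈ Metric.ball (0 : ℂ) 1
  · have hz' : ‖z‖ < 1 := by simpa using hz
    simp only [Set.indicator_of_mem hz, discWeight, Set.indicator_of_mem (Set.mem_Iio.2 hz')]
    rw [ENNReal.toReal_ofReal (radialWeight_nonneg hα (norm_nonneg z) hz'.le)]
  · have hz' : ‖z‖ ∉ Set.Iio (1 : ℝ) := by simpa using hz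
    simp only [Set.indicator_of_notMem hz, discWeight, Set.indicator_of_notMem hz', zero_smul]

theorem radial_integrand_eq (n : ℕ) :
    (Set.Ioi (0 : ℝ)).indicator (fun r => r ^ (2 - 1) • (discWeight α r * r ^ (2 * n)))
      = (Set.Ioo (0 : ℝ) 1).indicator
        fun r => (α + 1) / Real.pi * (r ^ (2 * n) * (r * (1 - r ^ 2) ^ α)) := by
  ext r
  by_cases h0 : 0 < r
  · by_cases h1 : r < 1
    · rw [Set.indicator_of_mem (Set.mem_Ioi.2 h0), Set.indicator_of_mem (Set.mem_Ioo.2 ⟨h0, h1⟩),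
        discWeight, Set.indicator_of_mem (Set.mem_Iio.2 h1), radialWeight, smul_eq_mul]
      ring
    · rw [Set.indicator_of_mem (Set.mem_Ioi.2 h0),
        Set.indicator_of_notMem (fun h => h1 h.2),
        discWeight, Set.indicator_of_notMem (by simpa using h1)]
      simp
  · rw [Set.indicator_of_notMem (by simpa using h0), Set.indicator_of_notMem (fun h => h0 h.1)]

theorem integrable_discWeight (hα : -1 < α) : Integrable fun z : ℂ => discWeight α ‖z‖ := by
  have h := (integrable_fun_norm_addHaar (volume : Measure ℂ)
    (f := fun r => discWeight α r * r ^ (2 * 0))).2 ?_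
  · simpa using h
  · rw [Complex.finrank_real_complex, ← integrable_indicator_iff measurableSet_Ioi,
      radial_integrand_eq, integrable_indicator_iff measurableSet_Ioo]
    exact ((intervalIntegrable_iff_integrableOn_Ioo_of_le zero_le_one).1
      ((intervalIntegrable_radial_mul hα 0).const_mul _))

theorem integral_norm_pow (hα : -1 < α) (n : ℕ) :
    ∫ z, ‖z‖ ^ (2 * n) ∂weightedArea α = radialMoment α n := by
  rw [integral_weightedArea hα]
  simp only [smul_eq_mul]
  rw [integral_fun_norm_addHaar (volume : Measure ℂ) fun r => discWeight α r * r ^ (2 * n),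
    Complex.finrank_real_complex, ← integral_indicator measurableSet_Ioi, radial_integrand_eq,
    integral_indicator measurableSet_Ioo, ← integral_Ioc_eq_integral_Ioo,
    ← intervalIntegral.integral_of_le zero_le_one, intervalIntegral.integral_const_mul,
    radialMoment, intervalIntegral.integral_const_mul, Measure.real, Complex.volume_ball]
  simp
  field_simp

theorem isFiniteMeasure_weightedArea (hα : -1 < α) : IsFiniteMeasure (weightedArea α) := by
  rw [weightedArea_eq]
  refine isFiniteMeasure_withDensity_ofReal ?_
  have h : IntegrableOn (fun z : ℂ => discWeight α ‖z‖) (Metric.ball 0 1) :=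
    (integrable_discWeight hα).integrableOn
  refine (h.congr_fun (fun z hz => ?_) Metric.isOpen_ball.measurableSet).2
  have hz' : ‖z‖ < 1 := by simpa using hz
  simp only [discWeight, Set.indicator_of_mem (Set.mem_Iio.2 hz')]

theorem setIntegral_rotation {F : Type*} [NormedAddCommGroup F] [NormedSpace ℝ F] (hα : -1 < α)
    (h : ℂ → F) (r : ℝ) (u : Circle) :
    ∫ z in Metric.ball 0 r, h (u * z) ∂weightedArea α
      = ∫ z in Metric.ball 0 r, h z ∂weightedArea α := by
  symm
  rw [← integral_indicator Metric.isOpen_ball.measurableSet,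
    ← integral_indicator Metric.isOpen_ball.measurableSet, integral_weightedArea hα,
    integral_weightedArea hα,
    ← (rotation u).measurePreserving.integral_comp
      (rotation u).toHomeomorph.measurableEmbedding]
  refine integral_congr_ae (ae_of_all _ fun z => ?_)
  have hn : ‖(u : ℂ) * z‖ = ‖z‖ := by rw [norm_mul, Circle.norm_coe, one_mul]
  simp only [rotation_apply, hn]
  congr 1
  by_cases hz : z ∈ Metric.ball (0 : ℂ) r
  · rw [Set.indicator_of_mem hz, Set.indicator_of_mem]
    rw [mem_ball_zero_iff] at hz ⊢
    rwa [hn]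
  · rw [Set.indicator_of_notMem hz, Set.indicator_of_notMem]
    rw [mem_ball_zero_iff] at hz ⊢
    rwa [hn]

theorem setIntegral_star_pow_mul_pow (hα : -1 < α) (r : ℝ) {m n : ℕ} (hmn : m ≠ n) :
    ∫ z in Metric.ball 0 r, star z ^ n * z ^ m ∂weightedArea α = 0 := by
  -- Rotation by this angle multiplies `z̄ⁿ zᵐ` by `exp (i θ (m - n)) = -1`, so the integral equals
  -- its negative.
  set θ : ℝ := Real.pi / ((m : ℝ) - n) with hθ
  have hne : (m : ℝ) - n ≠ 0 := sub_ne_zero.2 (by exact_mod_cast hmn)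
  have h := setIntegral_rotation hα (fun z : ℂ => star z ^ n * z ^ m) r (Circle.exp θ)
  have hu : star (Circle.exp θ : ℂ) ^ n * (Circle.exp θ : ℂ) ^ m = -1 := by
    rw [Circle.coe_exp, Complex.star_def, ← Complex.exp_conj, ← Complex.exp_nat_mul,
      ← Complex.exp_nat_mul, ← Complex.exp_add, ← Complex.exp_pi_mul_I]
    congr 1
    simp only [map_mul, Complex.conj_ofReal, Complex.conj_I]
    have : (Real.pi : ℂ) = θ * (m - n) := by
      rw [hθ]
      push_cast
      have : (m : ℂ) - n ≠ 0 := by exact_mod_cast hne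
      field_simp
    rw [this]
    ring
  have h2 : ∀ z : ℂ, star ((Circle.exp θ : ℂ) * z) ^ n * ((Circle.exp θ : ℂ) * z) ^ m
      = -(star z ^ n * z ^ m) := by
    intro z
    rw [star_mul, mul_pow, mul_pow]
    linear_combination (star z ^ n * z ^ m) * hu
  simp only [h2, integral_neg] at h
  exact neg_eq_self.1 h

theorem isPowerSeriesCoeff_of_hasSum {F : ℂ → ℍ} {c : ℕ → ℍ}
    (h : ∀ z ∈ Metric.ball (0 : ℂ) 1, HasSum (fun n => slicePoint J (z ^ n) * c n) (F z)) :
    IsPowerSeriesCoeff c := by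
  intro r h0 h1
  have := (h (r : ℂ) (by simpa [abs_of_nonneg h0] using h1)).summable.norm
  refine this.congr fun n => ?_
  rw [norm_mul, norm_slicePoint, norm_pow, Complex.norm_real, Real.norm_of_nonneg h0, mul_comm]

theorem norm_slicePoint_star_pow_mul (z : ℂ) (n : ℕ) (q : ℍ) :
    ‖slicePoint J (star z ^ n) * q‖ = ‖z‖ ^ n * ‖q‖ := by
  rw [norm_mul, norm_slicePoint, norm_pow, norm_star]

theorem integrable_star_pow_mul {g : ℂ → ℍ} (hg : Integrable g (weightedArea α)) (n : ℕ) :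
    Integrable (fun z => slicePoint J (star z ^ n) * g z) (weightedArea α) := by
  refine hg.mono ((continuous_slicePoint.comp (by fun_prop)).aestronglyMeasurable.mul
    hg.aestronglyMeasurable) ?_
  filter_upwards [ae_mem_ball] with z hz
  rw [norm_slicePoint_star_pow_mul]
  rw [mem_ball_zero_iff] at hz
  exact mul_le_of_le_one_left (norm_nonneg _) (pow_le_one₀ (norm_nonneg _) hz.le)

theorem iUnion_ball : ⋃ k : ℕ, Metric.ball (0 : ℂ) (1 - 1 / ((k : ℝ) + 1)) = Metric.ball 0 1 := by
  ext z
  simp only [Set.mem_iUnion, mem_ball_zero_iff]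
  constructor
  · rintro ⟨k, hk⟩
    have : 0 < 1 / ((k : ℝ) + 1) := by positivity
    linarith
  · intro h
    obtain ⟨k, hk⟩ := exists_nat_one_div_lt (sub_pos.2 h)
    exact ⟨k, by linarith⟩

theorem tendsto_setIntegral_ball {F : Type*} [NormedAddCommGroup F] [NormedSpace ℝ F]
    {g : ℂ → F} (hg : Integrable g (weightedArea α)) :
    Tendsto (fun k : ℕ => ∫ z in Metric.ball 0 (1 - 1 / ((k : ℝ) + 1)), g z ∂weightedArea α) atTop
      (𝓝 (∫ z, g z ∂weightedArea α)) := by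
  have h := tendsto_setIntegral_of_monotone (μ := weightedArea α) (f := g)
    (s := fun k : ℕ => Metric.ball (0 : ℂ) (1 - 1 / ((k : ℝ) + 1)))
    (fun k => Metric.isOpen_ball.measurableSet)
    (fun k l hkl => Metric.ball_subset_ball (by
      have : 1 / ((l : ℝ) + 1) ≤ 1 / ((k : ℝ) + 1) := Nat.one_div_le_one_div hkl
      linarith)) hg.integrableOn
  rwa [iUnion_ball, setIntegral_eq_integral_of_ae_compl_eq_zero] at h
  filter_upwards [ae_mem_ball] with z hz hz'
  exact absurd hz hz'

/-- The coefficients of a power series are its scalar products with the monomials. -/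
theorem integral_star_pow_mul (hα : -1 < α) {F : ℂ → ℍ} {c : ℕ → ℍ}
    (h : ∀ z ∈ Metric.ball (0 : ℂ) 1, HasSum (fun n => slicePoint J (z ^ n) * c n) (F z))
    (hF : Integrable F (weightedArea α)) (n : ℕ) :
    ∫ z, slicePoint J (star z ^ n) * F z ∂weightedArea α = radialMoment α n • c n := by
  have := isFiniteMeasure_weightedArea hα
  have hc := isPowerSeriesCoeff_of_hasSum h
  have hint : Integrable (fun z : ℂ => ‖z‖ ^ (2 * n)) (weightedArea α) := by
    refine (integrable_const (1 : ℝ)).mono (by fun_prop) ?_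
    filter_upwards [ae_mem_ball] with z hz
    rw [mem_ball_zero_iff] at hz
    rw [norm_pow, norm_norm, norm_one]
    exact pow_le_one₀ (norm_nonneg _) hz.le
  -- The series need not be summable in norm up to the unit circle, so sum and integral are
  -- exchanged on smaller discs, which then exhaust the unit disc.
  have key : ∀ k : ℕ, ∫ z in Metric.ball 0 (1 - 1 / ((k : ℝ) + 1)),
      slicePoint J (star z ^ n) * F z ∂weightedArea α
      = (∫ z in Metric.ball 0 (1 - 1 / ((k : ℝ) + 1)), ‖z‖ ^ (2 * n) ∂weightedArea α) • c n := by
    intro k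
    set r : ℝ := 1 - 1 / ((k : ℝ) + 1) with hr
    have hr1 : r < 1 := by
      have : 0 < 1 / ((k : ℝ) + 1) := by positivity
      linarith
    have hr0 : 0 ≤ r := by
      rw [hr, sub_nonneg, div_le_one (by positivity)]
      linarith [k.cast_nonneg (α := ℝ)]
    set μ := (weightedArea α).restrict (Metric.ball 0 r) with hμ
    have hmem : ∀ᵐ z ∂μ, z ∈ Metric.ball (0 : ℂ) r :=
      ae_restrict_mem Metric.isOpen_ball.measurableSet
    have hI : ∀ m : ℕ, Integrable (fun z : ℂ => star z ^ n * z ^ m) μ := by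
      intro m
      refine (integrable_const (1 : ℝ)).mono (by fun_prop) ?_
      filter_upwards [hmem] with z hz
      rw [mem_ball_zero_iff] at hz
      rw [norm_mul, norm_pow, norm_pow, norm_star, norm_one]
      exact mul_le_one₀ (pow_le_one₀ (norm_nonneg _) (hz.trans hr1).le) (by positivity)
        (pow_le_one₀ (norm_nonneg _) (hz.trans hr1).le)
    have hterm : ∀ m : ℕ, ∫ z, slicePoint J (star z ^ n * z ^ m) * c m ∂μ
        = slicePoint J (∫ z, star z ^ n * z ^ m ∂μ) * c m := by
      intro m
      rw [← sliceDeriv_apply, ← ContinuousLinearMap.integral_comp_comm _ (hI m)]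
      simp only [sliceDeriv_apply]
    have hIc : ∀ m : ℕ, Integrable (fun z : ℂ => slicePoint J (star z ^ n * z ^ m) * c m) μ := by
      intro m
      have := (sliceDeriv J (c m)).integrable_comp (hI m)
      simpa only [sliceDeriv_apply] using this
    have hsum := hasSum_integral_of_summable_integral_norm hIc (by
      refine Summable.of_nonneg_of_le (fun m => integral_nonneg fun z => norm_nonneg _)
        (fun m => ?_) ((hc r hr0 hr1).mul_left (μ.real Set.univ))
      have hle : ∀ᵐ z ∂μ, ‖slicePoint J (star z ^ n * z ^ m) * c m‖ ≤ ‖c m‖ * r ^ m := by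
        filter_upwards [hmem] with z hz
        rw [mem_ball_zero_iff] at hz
        rw [norm_mul, norm_slicePoint, norm_mul, norm_pow, norm_pow, norm_star, mul_comm]
        refine mul_le_mul_of_nonneg_left ?_ (norm_nonneg _)
        refine (mul_le_of_le_one_left (by positivity)
          (pow_le_one₀ (norm_nonneg _) (hz.trans hr1).le)).trans ?_
        exact pow_le_pow_left₀ (norm_nonneg _) hz.le m
      calc ∫ z, ‖slicePoint J (star z ^ n * z ^ m) * c m‖ ∂μ ≤ ∫ _, ‖c m‖ * r ^ m ∂μ :=
            integral_mono_ae (hIc m).norm (integrable_const _) hle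
        _ = μ.real Set.univ * (‖c m‖ * r ^ m) := by rw [integral_const, smul_eq_mul])
    have hswap : ∫ z, slicePoint J (star z ^ n) * F z ∂μ
        = ∫ z, ∑' m, slicePoint J (star z ^ n * z ^ m) * c m ∂μ := by
      refine integral_congr_ae ?_
      filter_upwards [hmem] with z hz
      have hs := (h z (Metric.ball_subset_ball hr1.le hz)).mul_left (slicePoint J (star z ^ n))
      rw [← hs.tsum_eq]
      refine tsum_congr fun m => ?_
      rw [slicePoint_mul, mul_assoc]
    rw [hswap]
    refine hsum.unique ?_
    convert hasSum_single n fun m hm => ?_ using 1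
    · rw [hterm]
      have : ∀ z : ℂ, star z ^ n * z ^ n = ((‖z‖ ^ (2 * n) : ℝ) : ℂ) := by
        intro z
        rw [← mul_pow, Complex.star_def, mul_comm, Complex.mul_conj, Complex.normSq_eq_norm_sq,
          pow_mul]
        push_cast
        rfl
      simp only [this]
      rw [integral_complex_ofReal, slicePoint_ofReal, Quaternion.coe_mul_eq_smul]
    · rw [hterm, hμ, setIntegral_star_pow_mul_pow hα r hm]
      simp [slicePoint]
  have h1 := tendsto_setIntegral_ball (integrable_star_pow_mul (J := J) hF n)
  have h2 := (tendsto_setIntegral_ball hint).smul_const (c n)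
  rw [integral_norm_pow hα] at h2
  exact tendsto_nhds_unique h1 (h2.congr fun k => (key k).symm)

end

section

variable {α : ℝ} {i : imaginaryUnits}

/-! ### The slice Bergman space -/

/-- Quaternionic conjugation as a real continuous linear map. -/
def starCLM : ℍ →L[ℝ] ℍ :=
  LinearMap.toContinuousLinearMap
    { toFun := star, map_add' := star_add, map_smul' := fun r q => Quaternion.star_smul r q }

namespace BergmanSpace

theorem inner_def (f g : BergmanSpace α i) : (inner ℍ f g : ℍ)
    = ∫ z, star (f (slicePoint i z)) * g (slicePoint i z) ∂weightedArea α := rfl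

theorem isLeftSliceHyperholomorphic (f : BergmanSpace α i) :
    IsLeftSliceHyperholomorphic unitBall f := f.2.1

theorem ext_slice {f g : BergmanSpace α i}
    (h : ∀ z ∈ Metric.ball (0 : ℂ) 1, f (slicePoint i z) = g (slicePoint i z)) : f = g := by
  refine Subtype.ext (funext fun q => ?_)
  by_cases hq : q ∈ unitBall
  · exact f.2.1.eq_of_eq_on_slice g.2.1 h hq
  · exact (f.2.2.1 q hq).trans (g.2.2.1 q hq).symm

theorem smul_apply (q : ℍ) (f : BergmanSpace α i) (x : ℍ) : (op q • f) x = f x * q := rfl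

theorem add_apply (f g : BergmanSpace α i) (x : ℍ) : (f + g) x = f x + g x := rfl

theorem integrable_star_mul (f g : BergmanSpace α i) :
    Integrable (fun z => star (f (slicePoint i z)) * g (slicePoint i z)) (weightedArea α) :=
  f.memLp.star.integrable_mul g.memLp

theorem star_inner (f g : BergmanSpace α i) : star (inner ℍ f g : ℍ) = inner ℍ g f := by
  rw [inner_def, inner_def]
  have h := starCLM.integral_comp_comm (integrable_star_mul f g)
  refine h.symm.trans (integral_congr_ae (ae_of_all _ fun z => ?_))
  change star (_ * _) = _
  rw [star_mul, star_star]

theorem inner_add_right (f g h : BergmanSpace α i) :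
    (inner ℍ f (g + h) : ℍ) = inner ℍ f g + inner ℍ f h := by
  simp only [inner_def, add_apply, mul_add]
  exact integral_add (integrable_star_mul f g) (integrable_star_mul f h)

theorem inner_smul_right (f g : BergmanSpace α i) (q : ℍ) :
    (inner ℍ f (op q • g) : ℍ) = inner ℍ f g * q := by
  simp only [inner_def, smul_apply, ← mul_assoc]
  exact (mulRight q).integral_comp_comm (integrable_star_mul f g)

theorem inner_self (f : BergmanSpace α i) : (inner ℍ f f : ℍ) = ((‖f‖ ^ 2 : ℝ) : ℍ) := by
  rw [norm_sq_eq, inner_def]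
  simp only [Quaternion.star_mul_self, Quaternion.normSq_eq_norm_mul_self, ← sq]
  have hi : Integrable (fun z => ‖f (slicePoint i z)‖ ^ 2) (weightedArea α) :=
    f.memLp.integrable_norm_pow two_ne_zero
  exact (Algebra.linearMap ℝ ℍ).toContinuousLinearMap.integral_comp_comm hi

instance : Module ℝ (BergmanSpace α i) := inferInstanceAs (Module ℝ (bergmanSubmodule α i))

instance : NormedSpace ℝ (BergmanSpace α i) where
  norm_smul_le r f := by
    have h : toL2 α i (r • f) = r • toL2 α i f := rfl
    change ‖toL2 α i (r • f)‖ ≤ ‖r‖ * ‖toL2 α i f‖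
    rw [h, norm_smul]

instance : IsScalarTower ℝ ℍᵐᵒᵖ (BergmanSpace α i) :=
  inferInstanceAs (IsScalarTower ℝ ℍᵐᵒᵖ (bergmanSubmodule α i))

end BergmanSpace

/-! ### The reproducing kernel -/

/-- The power series coefficients of the reproducing kernel at the point `w` of the slice. -/
def kernelCoeff (α : ℝ) (i : imaginaryUnits) (w : ℂ) (n : ℕ) : ℍ :=
  (radialMoment α n)⁻¹ • slicePoint i (star w ^ n)

theorem norm_kernelCoeff (hα : -1 < α) (w : ℂ) (n : ℕ) :
    ‖kernelCoeff α i w n‖ = (radialMoment α n)⁻¹ * ‖w‖ ^ n := by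
  rw [kernelCoeff, norm_smul, norm_slicePoint, norm_pow, norm_star,
    Real.norm_of_nonneg (inv_nonneg.2 (radialMoment_pos hα n).le)]

theorem isPowerSeriesCoeff_of_norm_le (hα : -1 < α) {c : ℕ → ℍ} {C : ℝ}
    (h : ∀ n, ‖c n‖ ≤ (radialMoment α n)⁻¹ * C) : IsPowerSeriesCoeff c := by
  intro r h0 h1
  refine Summable.of_nonneg_of_le (fun n => by positivity) (fun n => ?_)
    ((hasSum_inv_radialMoment hα h0 h1).summable.mul_left C)
  calc ‖c n‖ * r ^ n ≤ (radialMoment α n)⁻¹ * C * r ^ n :=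
        mul_le_mul_of_nonneg_right (h n) (by positivity)
    _ = C * ((radialMoment α n)⁻¹ * r ^ n) := by ring

theorem isPowerSeriesCoeff_kernelCoeff (hα : -1 < α) {w : ℂ} (hw : w ∈ Metric.ball (0 : ℂ) 1) :
    IsPowerSeriesCoeff (kernelCoeff α i w) := by
  rw [mem_ball_zero_iff] at hw
  refine isPowerSeriesCoeff_of_norm_le hα (C := 1) fun n => ?_
  rw [norm_kernelCoeff hα]
  exact mul_le_mul_of_nonneg_left (pow_le_one₀ (norm_nonneg _) hw.le)
    (inv_nonneg.2 (radialMoment_pos hα n).le)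

theorem norm_powerSum_kernelCoeff_le (hα : -1 < α) {w z : ℂ} (hw : w ∈ Metric.ball (0 : ℂ) 1)
    (hz : z ∈ Metric.ball (0 : ℂ) 1) :
    ‖powerSum (kernelCoeff α i w) (slicePoint i z)‖ ≤ ((1 - ‖w‖) ^ (α + 2))⁻¹ := by
  have hw' := mem_ball_zero_iff.1 hw
  have hz' := mem_ball_zero_iff.1 hz
  refine ((isPowerSeriesCoeff_kernelCoeff hα hw).hasSum hz).norm_le_of_bounded
    (hasSum_inv_radialMoment hα (norm_nonneg w) hw') fun n => ?_
  rw [norm_mul, norm_kernelCoeff hα, norm_slicePoint, norm_pow]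
  exact mul_le_of_le_one_left (mul_nonneg (inv_nonneg.2 (radialMoment_pos hα n).le)
    (by positivity)) (pow_le_one₀ (norm_nonneg _) hz'.le)

theorem aestronglyMeasurable_slice {f : ℍ → ℍ} (hf : DifferentiableOn ℝ f unitBall) :
    AEStronglyMeasurable (fun z => f (slicePoint i z)) (weightedArea α) := by
  have h : ContinuousOn (fun z => f (slicePoint i z)) (Metric.ball 0 1) :=
    hf.continuousOn.comp continuous_slicePoint.continuousOn
      fun z hz => slicePoint_mem_unitBall.2 hz
  exact (h.aestronglyMeasurable Metric.isOpen_ball.measurableSet).mono_ac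
    (withDensity_absolutelyContinuous _ _)

theorem memLp_powerSum_kernelCoeff (hα : -1 < α) {w : ℂ} (hw : w ∈ Metric.ball (0 : ℂ) 1)
    (p : ℝ≥0∞) :
    MemLp (fun z => powerSum (kernelCoeff α i w) (slicePoint i z)) p (weightedArea α) := by
  have := isFiniteMeasure_weightedArea hα
  refine MemLp.of_bound
    (aestronglyMeasurable_slice (isPowerSeriesCoeff_kernelCoeff hα hw).differentiableOn)
    ((1 - ‖w‖) ^ (α + 2))⁻¹ ?_
  filter_upwards [ae_mem_ball] with z hz
  exact norm_powerSum_kernelCoeff_le hα hw hz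

theorem powerSum_eq_zero (c : ℕ → ℍ) {x : ℍ} (hx : x ∉ unitBall) : powerSum c x = 0 :=
  Set.indicator_of_notMem hx _

/-- The power series of the kernel, as an element of the Bergman space. -/
def kernelElement (hα : -1 < α) (i : imaginaryUnits) {w : ℂ} (hw : w ∈ Metric.ball (0 : ℂ) 1) :
    BergmanSpace α i :=
  ⟨powerSum (kernelCoeff α i w), (isPowerSeriesCoeff_kernelCoeff hα hw).isLeftSliceHyperholomorphic,
    fun _ hx => powerSum_eq_zero _ hx, memLp_powerSum_kernelCoeff hα hw 2⟩

/-- The power series coefficients of the projection of `g` to the Bergman space. -/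
def projectionCoeff (α : ℝ) (i : imaginaryUnits) (g : ℂ → ℍ) (n : ℕ) : ℍ :=
  (radialMoment α n)⁻¹ • ∫ z, slicePoint i (star z ^ n) * g z ∂weightedArea α

theorem norm_integral_star_pow_mul_le {g : ℂ → ℍ} (hg : Integrable g (weightedArea α)) (n : ℕ) :
    ∫ z, ‖slicePoint i (star z ^ n) * g z‖ ∂weightedArea α ≤ ∫ z, ‖g z‖ ∂weightedArea α := by
  refine integral_mono_ae (integrable_star_pow_mul hg n).norm hg.norm ?_
  filter_upwards [ae_mem_ball] with z hz
  rw [norm_slicePoint_star_pow_mul]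
  exact mul_le_of_le_one_left (norm_nonneg _)
    (pow_le_one₀ (norm_nonneg _) (mem_ball_zero_iff.1 hz).le)

theorem isPowerSeriesCoeff_projectionCoeff (hα : -1 < α) {g : ℂ → ℍ}
    (hg : Integrable g (weightedArea α)) : IsPowerSeriesCoeff (projectionCoeff α i g) := by
  refine isPowerSeriesCoeff_of_norm_le hα (C := ∫ z, ‖g z‖ ∂weightedArea α) fun n => ?_
  have h := inv_nonneg.2 (radialMoment_pos hα n).le
  rw [projectionCoeff, norm_smul, Real.norm_of_nonneg h]
  exact mul_le_mul_of_nonneg_left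
    ((norm_integral_le_integral_norm _).trans (norm_integral_star_pow_mul_le hg n)) h

/-- Integration against the kernel is the projection to power series. -/
theorem integral_star_kernel_mul (hα : -1 < α) {w : ℂ} (hw : w ∈ Metric.ball (0 : ℂ) 1)
    {g : ℂ → ℍ} (hg : Integrable g (weightedArea α)) :
    ∫ z, star (powerSum (kernelCoeff α i w) (slicePoint i z)) * g z ∂weightedArea α
      = powerSum (projectionCoeff α i g) (slicePoint i w) := by
  have hc := isPowerSeriesCoeff_projectionCoeff (i := i) hα hg
  have hw' := mem_ball_zero_iff.1 hw
  set q : ℕ → ℍ := fun n => (radialMoment α n)⁻¹ • slicePoint i (w ^ n) with hq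
  have hqn : ∀ n, ‖q n‖ = (radialMoment α n)⁻¹ * ‖w‖ ^ n := fun n => by
    rw [hq, norm_smul, norm_slicePoint, norm_pow,
      Real.norm_of_nonneg (inv_nonneg.2 (radialMoment_pos hα n).le)]
  have hI : ∀ n, Integrable (fun z => q n * (slicePoint i (star z ^ n) * g z)) (weightedArea α) :=
    fun n => (integrable_star_pow_mul hg n).const_mul (q n)
  have hsum := hasSum_integral_of_summable_integral_norm hI (by
    refine Summable.of_nonneg_of_le (fun n => integral_nonneg fun z => norm_nonneg _)
      (fun n => ?_) ((hasSum_inv_radialMoment hα (norm_nonneg w) hw').summable.mul_right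
        (∫ z, ‖g z‖ ∂weightedArea α))
    simp only [norm_mul (q n), hqn]
    rw [integral_const_mul]
    exact mul_le_mul_of_nonneg_left (norm_integral_star_pow_mul_le hg n)
      (mul_nonneg (inv_nonneg.2 (radialMoment_pos hα n).le) (by positivity)))
  have hswap : ∫ z, star (powerSum (kernelCoeff α i w) (slicePoint i z)) * g z ∂weightedArea α
      = ∫ z, ∑' n, q n * (slicePoint i (star z ^ n) * g z) ∂weightedArea α := by
    refine integral_congr_ae ?_
    filter_upwards [ae_mem_ball] with z hz
    have hs := ((isPowerSeriesCoeff_kernelCoeff (i := i) hα hw).hasSum (J := i) hz).star.mul_right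
      (g z)
    rw [← hs.tsum_eq]
    refine tsum_congr fun n => ?_
    rw [kernelCoeff, star_mul, Quaternion.star_smul, star_slicePoint, star_slicePoint, star_pow,
      star_star, star_pow, mul_assoc]
  rw [hswap]
  refine hsum.unique ?_
  refine (hc.hasSum hw).congr_fun fun n => ?_
  rw [projectionCoeff, hq, mul_smul_comm, ← smul_mul_assoc]
  exact (ContinuousLinearMap.mul ℝ ℍ (q n)).integral_comp_comm (integrable_star_pow_mul hg n)

theorem integrable_of_memLp_two (hα : -1 < α) {g : ℂ → ℍ} (hg : MemLp g 2 (weightedArea α)) :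
    Integrable g (weightedArea α) := by
  have := isFiniteMeasure_weightedArea hα
  exact hg.integrable one_le_two

/-- Pairing with the kernel sums the projection coefficients of `f`, and by `integral_star_pow_mul`
these are its own power series coefficients. -/
theorem inner_kernelElement (hα : -1 < α) {w : ℂ} (hw : w ∈ Metric.ball (0 : ℂ) 1)
    (f : BergmanSpace α i) : (inner ℍ (kernelElement hα i hw) f : ℍ) = f (slicePoint i w) := by
  have hf := integrable_of_memLp_two hα f.memLp
  obtain ⟨c, hc⟩ := f.isLeftSliceHyperholomorphic.exists_hasSum i
  have hproj : projectionCoeff α i (fun z => f (slicePoint i z)) = c := by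
    ext1 n
    rw [projectionCoeff, integral_star_pow_mul hα hc hf, inv_smul_smul₀ (radialMoment_pos hα n).ne']
  refine (integral_star_kernel_mul hα hw hf).trans ?_
  rw [hproj]
  exact ((isPowerSeriesCoeff_of_hasSum hc).hasSum hw).unique (hc w hw)

theorem inner_kernel (hα : -1 < α) {w : ℂ} (hw : w ∈ Metric.ball (0 : ℂ) 1)
    (f : BergmanSpace α i) :
    (inner ℍ (kernel α i (slicePoint i w)) f : ℍ) = f (slicePoint i w) := by
  have h : ∃ K : BergmanSpace α i, ∀ f : BergmanSpace α i, inner ℍ K f = f (slicePoint i w) :=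
    ⟨kernelElement hα i hw, inner_kernelElement hα hw⟩
  rw [kernel, dif_pos h]
  exact h.choose_spec f

theorem kernelElement_apply_self (hα : -1 < α) {w : ℂ} (hw : w ∈ Metric.ball (0 : ℂ) 1) :
    kernelElement hα i hw (slicePoint i w) = ((((1 - ‖w‖ ^ 2) ^ (α + 2))⁻¹ : ℝ) : ℍ) := by
  have hw' := mem_ball_zero_iff.1 hw
  have h1 := (isPowerSeriesCoeff_kernelCoeff (i := i) hα hw).hasSum (J := i) hw
  have h2 := (hasSum_inv_radialMoment hα (sq_nonneg ‖w‖)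
    (pow_lt_one₀ (norm_nonneg _) hw' two_ne_zero)).map (algebraMap ℝ ℍ)
    (continuous_algebraMap ℝ ℍ)
  refine h1.unique (h2.congr_fun fun n => ?_)
  rw [kernelCoeff, mul_smul_comm, ← slicePoint_mul, ← mul_pow, Complex.star_def, Complex.mul_conj,
    Complex.normSq_eq_norm_sq, ← Complex.ofReal_pow, slicePoint_ofReal, ← Quaternion.coe_mul_eq_smul,
    ← Quaternion.coe_mul]
  rfl

/-- `kernel` is a chosen witness, so its value is read off by pairing it with the explicit
`kernelElement`: both reproduce values at `w`. -/
theorem kernel_apply_self (hα : -1 < α) {w : ℂ} (hw : w ∈ Metric.ball (0 : ℂ) 1) :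
    kernel α i (slicePoint i w) (slicePoint i w)
      = ((((1 - ‖w‖ ^ 2) ^ (α + 2))⁻¹ : ℝ) : ℍ) := by
  rw [← inner_kernelElement hα hw, ← BergmanSpace.star_inner, inner_kernel hα hw,
    kernelElement_apply_self hα hw, Quaternion.star_coe]

/-! ### Definiteness and completeness -/

theorem BergmanSpace.isometry_toL2 : Isometry (BergmanSpace.toL2 α i) :=
  AddMonoidHomClass.isometry_of_norm _ fun _ => rfl

/-- Vanishing almost everywhere becomes vanishing at every point of the slice, since `f(w)` is an
integral of `f` against the kernel. -/
theorem BergmanSpace.eq_zero_of_norm_eq_zero (hα : -1 < α) (f : BergmanSpace α i)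
    (hf : ‖f‖ = 0) : f = 0 := by
  refine BergmanSpace.ext_slice fun w hw => ?_
  have h0 : BergmanSpace.toL2 α i f = 0 := norm_eq_zero.1 hf
  have hae : (fun z => f (slicePoint i z)) =ᵐ[weightedArea α] 0 :=
    (f.memLp.coeFn_toLp).symm.trans ((Lp.ext_iff.1 h0).trans (Lp.coeFn_zero _ _ _))
  rw [← inner_kernelElement hα hw, BergmanSpace.inner_def, integral_eq_zero_of_ae]
  · rfl
  · filter_upwards [hae] with z hz
    rw [hz]
    simp

/-- The space is closed in `L²`: if `f_k → g`, then `f_k(w) = ⟨K_w, f_k⟩` converges to the power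
series projection of `g` at `w`, while a subsequence converges to `g` almost everywhere. So `g`
agrees almost everywhere with a power series. -/
theorem BergmanSpace.completeSpace (hα : -1 < α) (i : imaginaryUnits) :
    CompleteSpace (BergmanSpace α i) := by
  have := isFiniteMeasure_weightedArea hα
  rw [completeSpace_iff_isComplete_range BergmanSpace.isometry_toL2.isUniformInducing]
  refine IsClosed.isComplete (isClosed_of_closure_subset fun g hg => ?_)
  obtain ⟨x, hx, hlim⟩ := mem_closure_iff_seq_limit.1 hg
  choose f hf using hx
  have hgL : MemLp g 2 (weightedArea α) := Lp.memLp g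
  have hgi := integrable_of_memLp_two hα hgL
  have hc := isPowerSeriesCoeff_projectionCoeff (i := i) hα hgi
  have hL2 : Tendsto (fun k => eLpNorm ((fun z => f k (slicePoint i z)) - (g : ℂ → ℍ)) 2 (weightedArea α))
      atTop (𝓝 0) := by
    refine ((Lp.tendsto_Lp_iff_tendsto_eLpNorm' _ _).1 hlim).congr fun k => eLpNorm_congr_ae ?_
    rw [← hf k]
    exact (f k).memLp.coeFn_toLp.sub (ae_eq_refl _)
  have hpt : ∀ w ∈ Metric.ball (0 : ℂ) 1, Tendsto (fun k => f k (slicePoint i w)) atTop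
      (𝓝 (powerSum (projectionCoeff α i g) (slicePoint i w))) := by
    intro w hw
    rw [← integral_star_kernel_mul hα hw hgi]
    simp only [← inner_kernelElement hα hw, BergmanSpace.inner_def]
    have hKi := (memLp_powerSum_kernelCoeff (i := i) hα hw 2).star
    refine tendsto_integral_of_L1' _ (hKi.integrable_mul hgL).aestronglyMeasurable
      (Eventually.of_forall fun k => BergmanSpace.integrable_star_mul _ _) ?_
    set B : ℝ := ((1 - ‖w‖) ^ (α + 2))⁻¹ with hB
    -- `B` bounds the kernel, and the power of the total mass is the Hölder constant from `L²` to
    -- `L¹`.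
    set M : ℝ≥0∞ := ENNReal.ofReal B * weightedArea α Set.univ ^ ((1 : ℝ) - 1 / 2) with hM
    have hMtop : M ≠ ⊤ := by
      refine ENNReal.mul_ne_top ENNReal.ofReal_ne_top ?_
      exact (ENNReal.rpow_lt_top_of_nonneg (by norm_num) (measure_ne_top _ _)).ne
    have h0 := ENNReal.Tendsto.const_mul hL2 (Or.inr hMtop)
    rw [mul_zero] at h0
    refine tendsto_of_tendsto_of_tendsto_of_le_of_le tendsto_const_nhds h0 (fun _ => zero_le)
      fun k => ?_
    have h1 : eLpNorm ((fun z => star (kernelElement hα i hw (slicePoint i z)) *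
        f k (slicePoint i z)) - fun z => star (powerSum (kernelCoeff α i w) (slicePoint i z)) * g z)
        1 (weightedArea α) ≤ ENNReal.ofReal B *
          eLpNorm ((fun z => f k (slicePoint i z)) - (g : ℂ → ℍ)) 1 (weightedArea α) := by
      refine eLpNorm_le_mul_eLpNorm_of_ae_le_mul ?_ _
      filter_upwards [ae_mem_ball] with z hz
      simp only [Pi.sub_apply]
      change ‖star (powerSum (kernelCoeff α i w) (slicePoint i z)) * f k (slicePoint i z)
        - star (powerSum (kernelCoeff α i w) (slicePoint i z)) * g z‖ ≤ _
      rw [← mul_sub, norm_mul, norm_star]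
      exact mul_le_mul_of_nonneg_right (norm_powerSum_kernelCoeff_le hα hw hz) (norm_nonneg _)
    have h2 : eLpNorm ((fun z => f k (slicePoint i z)) - (g : ℂ → ℍ)) 1 (weightedArea α)
        ≤ eLpNorm ((fun z => f k (slicePoint i z)) - (g : ℂ → ℍ)) 2 (weightedArea α)
          * weightedArea α Set.univ ^ ((1 : ℝ) - 1 / 2) := by
      simpa using eLpNorm_le_eLpNorm_mul_rpow_measure_univ (μ := weightedArea α) one_le_two
        ((f k).memLp.sub hgL).aestronglyMeasurable
    refine h1.trans ((mul_le_mul_right h2 _).trans (le_of_eq ?_))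
    rw [hM]
    ring
  obtain ⟨φ, hφ, hae⟩ := (tendstoInMeasure_of_tendsto_eLpNorm two_ne_zero
    (fun k => (f k).memLp.aestronglyMeasurable) hgL.aestronglyMeasurable hL2).exists_seq_tendsto_ae
  have heq : (fun z => powerSum (projectionCoeff α i g) (slicePoint i z)) =ᵐ[weightedArea α] g := by
    filter_upwards [hae, ae_mem_ball] with z hz hzb
    exact tendsto_nhds_unique ((hpt z hzb).comp hφ.tendsto_atTop) hz
  have hP := (memLp_congr_ae heq).2 hgL
  exact ⟨⟨powerSum (projectionCoeff α i g), hc.isLeftSliceHyperholomorphic,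
    fun _ hx => powerSum_eq_zero _ hx, hP⟩, Lp.ext (hP.coeFn_toLp.trans heq)⟩

end

section

variable {α : ℝ} {i : imaginaryUnits}

/-! ### The trace formula -/

/-- For `α > -1` the norm of the Bergman space is definite. -/
abbrev BergmanSpace.normedAddCommGroup (hα : -1 < α) (i : imaginaryUnits) :
    NormedAddCommGroup (BergmanSpace α i) :=
  NormedAddCommGroup.ofSeparation (BergmanSpace.eq_zero_of_norm_eq_zero hα)

theorem BergmanSpace.quaternionicInnerProductSpace (hα : -1 < α) (i : imaginaryUnits) :
    letI := BergmanSpace.normedAddCommGroup hα i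
    QuaternionicInnerProductSpace (BergmanSpace α i) :=
  letI := BergmanSpace.normedAddCommGroup hα i
  { star_inner := BergmanSpace.star_inner
    inner_add_right' := BergmanSpace.inner_add_right
    inner_smul_right' := BergmanSpace.inner_smul_right
    inner_self := BergmanSpace.inner_self }

theorem norm_inner_kernel (hα : -1 < α) {z : ℂ} (hz : z ∈ Metric.ball (0 : ℂ) 1)
    (f : BergmanSpace α i) :
    ‖(inner ℍ f (kernel α i (slicePoint i z)) : ℍ)‖ = ‖f (slicePoint i z)‖ := by
  rw [← BergmanSpace.star_inner, norm_star, inner_kernel hα hz]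

theorem lintegral_norm_sq (f : BergmanSpace α i) :
    ∫⁻ z, ENNReal.ofReal (‖f (slicePoint i z)‖ ^ 2) ∂weightedArea α
      = ENNReal.ofReal (‖f‖ ^ 2) := by
  rw [BergmanSpace.norm_sq_eq, ofReal_integral_eq_lintegral_ofReal
    (f.memLp.integrable_norm_pow two_ne_zero) (ae_of_all _ fun _ => sq_nonneg _)]

theorem aemeasurable_norm_sq (f : BergmanSpace α i) :
    AEMeasurable (fun z => ENNReal.ofReal (‖f (slicePoint i z)‖ ^ 2)) (weightedArea α) :=
  (f.memLp.aestronglyMeasurable.norm.aemeasurable.pow_const 2).ennreal_ofReal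

variable {T : BergmanSpace α i →L[ℍᵐᵒᵖ] BergmanSpace α i}

theorem lintegral_form_of_hasSum (hα : -1 < α) {u : ℕ → BergmanSpace α i}
    (h : ∀ x, HasSum (fun n => ‖(inner ℍ (u n) x : ℍ)‖ ^ 2) (inner ℍ x (T x) : ℍ).re) :
    ∫⁻ z, ENNReal.ofReal (inner ℍ (kernel α i (slicePoint i z))
      (T (kernel α i (slicePoint i z))) : ℍ).re ∂weightedArea α
      = ∑' n, ENNReal.ofReal (‖u n‖ ^ 2) := by
  simp only [← lintegral_norm_sq]
  rw [← lintegral_tsum fun n => aemeasurable_norm_sq (u n)]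
  refine lintegral_congr_ae ?_
  filter_upwards [ae_mem_ball] with z hz
  have hs := h (kernel α i (slicePoint i z))
  simp only [norm_inner_kernel hα hz] at hs
  rw [← hs.tsum_eq, ENNReal.ofReal_tsum_of_nonneg (fun n => sq_nonneg _) hs.summable]

/-- One-sided version of the trace formula, for operators whose singular numbers do not decay. -/
theorem sum_le_lintegral_form (hα : -1 < α) {u : ℕ → BergmanSpace α i} {n : ℕ}
    (h : ∀ x, ∑ k ∈ Finset.range n, ‖(inner ℍ (u k) x : ℍ)‖ ^ 2 ≤ (inner ℍ x (T x) : ℍ).re) :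
    ∑ k ∈ Finset.range n, ENNReal.ofReal (‖u k‖ ^ 2)
      ≤ ∫⁻ z, ENNReal.ofReal (inner ℍ (kernel α i (slicePoint i z))
          (T (kernel α i (slicePoint i z))) : ℍ).re ∂weightedArea α := by
  simp only [← lintegral_norm_sq]
  rw [← lintegral_finsetSum' _ fun k _ => aemeasurable_norm_sq (u k)]
  refine lintegral_mono_ae ?_
  filter_upwards [ae_mem_ball] with z hz
  have hs := h (kernel α i (slicePoint i z))
  simp only [norm_inner_kernel hα hz] at hs
  rw [← ENNReal.ofReal_sum_of_nonneg fun k _ => sq_nonneg _]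
  exact ENNReal.ofReal_le_ofReal hs

theorem berezin_re (hα : -1 < α) {z : ℂ} (hz : z ∈ Metric.ball (0 : ℂ) 1) :
    (berezin T (slicePoint i z)).re = (1 - ‖z‖ ^ 2) ^ (α + 2) *
      (inner ℍ (kernel α i (slicePoint i z)) (T (kernel α i (slicePoint i z))) : ℍ).re := by
  have h0 : 0 < 1 - ‖z‖ ^ 2 := by
    have := mem_ball_zero_iff.1 hz
    nlinarith [norm_nonneg z]
  have h1 : 0 < (1 - ‖z‖ ^ 2) ^ (α + 2) := Real.rpow_pos_of_pos h0 _
  have hleft : ∀ (f g : BergmanSpace α i) (q : ℍ),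
      (inner ℍ (op q • f) g : ℍ) = star q * inner ℍ f g := fun f g q => by
    rw [← BergmanSpace.star_inner, BergmanSpace.inner_smul_right, star_mul,
      BergmanSpace.star_inner]
  rw [berezin, normalizedKernel, map_smul, BergmanSpace.inner_smul_right, hleft,
    kernel_apply_self hα hz, Quaternion.re_coe, Quaternion.star_coe, ← Quaternion.coe_commutes,
    ← mul_assoc, ← Quaternion.coe_mul, Quaternion.coe_mul_eq_smul, Quaternion.re_smul, smul_eq_mul,
    ← mul_inv, Real.mul_self_sqrt (by positivity), inv_inv]

/-- The factor `(1 - |z|²)^(α+2)` from normalizing the kernel turns the Möbius density into that of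
`dA_α`. The densities are finite, so measurability of the Berezin transform is not needed. -/
theorem lintegral_berezin (hα : -1 < α) :
    ENNReal.ofReal (α + 1) *
        ∫⁻ z, ENNReal.ofReal (berezin T (slicePoint i z)).re ∂mobiusMeasure
      = ∫⁻ z, ENNReal.ofReal (inner ℍ (kernel α i (slicePoint i z))
          (T (kernel α i (slicePoint i z))) : ℍ).re ∂weightedArea α := by
  rw [mobiusMeasure, weightedArea,
    lintegral_withDensity_eq_lintegral_mul_non_measurable _ (by fun_prop)
      (ae_of_all _ fun _ => ENNReal.ofReal_lt_top),
    lintegral_withDensity_eq_lintegral_mul_non_measurable _ (by fun_prop)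
      (ae_of_all _ fun _ => ENNReal.ofReal_lt_top),
    ← lintegral_const_mul' _ _ ENNReal.ofReal_ne_top]
  refine lintegral_congr_ae ?_
  filter_upwards [ae_restrict_mem Metric.isOpen_ball.measurableSet] with z hz
  have h0 : 0 < 1 - ‖z‖ ^ 2 := by
    have := mem_ball_zero_iff.1 hz
    nlinarith [norm_nonneg z]
  have hα1 : 0 ≤ α + 1 := by linarith
  have h1 : 0 ≤ 1 / (Real.pi * (1 - ‖z‖ ^ 2) ^ 2) := by positivity
  have h2 : 0 ≤ (α + 1) / Real.pi * (1 - ‖z‖ ^ 2) ^ α := by positivity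
  simp only [Pi.mul_apply]
  rw [berezin_re hα hz, ← ENNReal.ofReal_mul h1, ← ENNReal.ofReal_mul hα1, ← ENNReal.ofReal_mul h2,
    Real.rpow_add h0, Real.rpow_two]
  congr 1
  field_simp

theorem tsum_eq_of_exists_hasSum (hα : -1 < α) {s : ℕ → ℝ}
    (h : ∃ u : ℕ → BergmanSpace α i, (∀ n, ‖u n‖ ^ 2 = s n) ∧
      ∀ x, HasSum (fun n => ‖(inner ℍ (u n) x : ℍ)‖ ^ 2) (inner ℍ x (T x) : ℍ).re) :
    ∑' n, ENNReal.ofReal (s n) = ENNReal.ofReal (α + 1) *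
      ∫⁻ z, ENNReal.ofReal (berezin T (slicePoint i z)).re ∂mobiusMeasure := by
  obtain ⟨u, hu, hsum⟩ := h
  rw [lintegral_berezin hα, lintegral_form_of_hasSum hα hsum]
  simp only [hu]

theorem tsum_singularNumber (hα : -1 < α) (hT : IsPositiveOperator T) :
    ∑' n, ENNReal.ofReal (singularNumber T n) = ENNReal.ofReal (α + 1) *
      ∫⁻ z, ENNReal.ofReal (berezin T (slicePoint i z)).re ∂mobiusMeasure := by
  -- This norm extends the given seminorm structure, so `T` and its singular numbers keep their
  -- meaning.
  let := BergmanSpace.normedAddCommGroup hα i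
  have := BergmanSpace.quaternionicInnerProductSpace hα i
  have := BergmanSpace.completeSpace hα i
  by_cases h0 : Tendsto (singularNumber T) atTop (𝓝 0)
  · exact tsum_eq_of_exists_hasSum hα (hT.exists_hasSum_of_tendsto h0)
  -- A nonnegative decreasing sequence that does not tend to `0` is bounded below; then both sides
  -- are infinite.
  · obtain ⟨δ, hδ, hs⟩ : ∃ δ > 0, ∀ n, δ ≤ singularNumber T n := by
      by_contra! hcon
      refine h0 (tendsto_order.2 ⟨fun a ha => Eventually.of_forall fun n =>
        ha.trans_le (singularNumber_nonneg T n), fun a ha => ?_⟩)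
      obtain ⟨n, hn⟩ := hcon a ha
      filter_upwards [eventually_ge_atTop n] with m hm
      exact (antitone_singularNumber T hm).trans_lt hn
    have htop : ∀ {a : ℝ≥0∞} {ε : ℝ}, 0 < ε → (∀ n : ℕ, n * ENNReal.ofReal ε ≤ a) → a = ⊤ := by
      intro a ε hε ha
      have h1 : ∑' _ : ℕ, ENNReal.ofReal ε = ⊤ :=
        ENNReal.tsum_const_eq_top_of_ne_zero (by simpa using hε)
      rw [eq_top_iff, ← h1, ENNReal.tsum_eq_iSup_nat]
      exact iSup_le fun n => by simpa using ha n
    rw [lintegral_berezin hα]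
    refine (htop hδ fun n => ?_).trans (htop (half_pos hδ) fun n => ?_).symm
    · have h := Finset.card_nsmul_le_sum (Finset.range n)
        (fun k => ENNReal.ofReal (singularNumber T k)) (ENNReal.ofReal δ)
        fun k _ => ENNReal.ofReal_le_ofReal (hs k)
      rw [Finset.card_range, nsmul_eq_mul] at h
      exact h.trans (ENNReal.sum_le_tsum _)
    · obtain ⟨u, hu, hle⟩ := hT.exists_family hδ hs n
      have h := Finset.card_nsmul_le_sum (Finset.range n)
        (fun k => ENNReal.ofReal (‖u k‖ ^ 2)) (ENNReal.ofReal (δ / 2))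
        fun k hk => ENNReal.ofReal_le_ofReal (hu k (Finset.mem_range.1 hk))
      rw [Finset.card_range, nsmul_eq_mul] at h
      exact h.trans (sum_le_lintegral_form hα hle)

theorem tsum_singularValueSeq (hα : -1 < α) (hT : IsPositiveOperator T) {s : ℕ → ℝ}
    (hs : IsSingularValueSeq T s) :
    ∑' n, ENNReal.ofReal (s n) = ENNReal.ofReal (α + 1) *
      ∫⁻ z, ENNReal.ofReal (berezin T (slicePoint i z)).re ∂mobiusMeasure := by
  let := BergmanSpace.normedAddCommGroup hα i
  have := BergmanSpace.quaternionicInnerProductSpace hα i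
  exact tsum_eq_of_exists_hasSum hα (hT.exists_hasSum_of_isSingularValueSeq hs)

end

end SliceBergman

end

/-- The real part loses nothing, since positivity makes the Berezin transform real and nonnegative.
The index `n` starts at `0`, so `singularNumber T n` is `λ_{n+1}`. -/
theorem mainTheorem3 (α : ℝ) (hα : -1 < α) (i : SliceBergman.imaginaryUnits)
    (T : SliceBergman.BergmanSpace α i →L[ℍᵐᵒᵖ] SliceBergman.BergmanSpace α i)
    (hT : SliceBergman.IsPositiveOperator T) :
    (∑' n : ℕ, ENNReal.ofReal (SliceBergman.singularNumber T n) =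
      ENNReal.ofReal (α + 1) *
        ∫⁻ z : ℂ, ENNReal.ofReal (SliceBergman.berezin T (SliceBergman.slicePoint i z)).re
          ∂SliceBergman.mobiusMeasure) ∧
    (∀ s : ℕ → ℝ, SliceBergman.IsSingularValueSeq T s →
      ∑' n : ℕ, ENNReal.ofReal (s n) =
        ENNReal.ofReal (α + 1) *
          ∫⁻ z : ℂ, ENNReal.ofReal (SliceBergman.berezin T (SliceBergman.slicePoint i z)).re
            ∂SliceBergman.mobiusMeasure) :=
  ⟨SliceBergman.tsum_singularNumber hα hT,
    fun _ hs => SliceBergman.tsum_singularValueSeq hα hT hs⟩
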